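/- Consider a random-access network with finite node set $V$ and interference graph $G$ on $V$, and let $\Omega\subseteq\{0,1\}^V$ be the set of indicator vectors of independent sets of $G$ (the feasible activity states). Packets arrive at node $i$ as a Poisson process of rate $\lambda_i>0$, and transmission times and back-off times at node $i$ are exponential with rates $\mu_i>0$ and $\nu_i>0$. Activation and release probabilities are fixed: $\phi_i,\psi_i\in(0,1]$. Thus the pair $(U,X)$ of activity state and queue lengths is the continuous-time Markov process on $\Omega\times\mathbb N_0^V$ with, for each $i\in V$, transitions from $(u,x)$ to - $(u,x+e_i)$ at rate $\lambda_i$; - $(u+e_i,x)$ at rate $\nu_i\phi_i$, if $u_i=0$ and $u_j=0$ for all neighbours $j$ of $i$; - $(u,x-e_i\mathbf 1\{x_i>0\})$ at rate $\mu_i(1-\psi_i)$, if $u_i=1$; - $(u-e_i,x-e_i\mathbf 1\{x_i>0\})$ at rate $\mu_i\psi_i$, if $u_i=1$. Suppose that the system is stable, and let $(U,X)$ have a stationary distribution of this process (a probability distribution satisfying the global balance equations). For $u\in\Omega$ put $\pi(u)=\mathbb P(U=u)$. For non-empty $S\subseteq\Omega$ put $\pi(S)=\sum_{u\in S}\pi(u)$,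 $Q(S)=\sum_{u\in S}\sum_{u'\in\Omega\setminus S}\pi(u)q(u,u')$, where $q(u,u+e_i)=\nu_i\phi_i$ and $q(u+e_i,u)=\mu_i\psi_i$ for $u,u+e_i\in\Omega$ and all other rates are $0$, and $\Phi(S)=Q(S)/\pi(S)$. For $w\in\mathbb R_+^V$ and $V'\subseteq V$ put $$D(w,V',S)=\sum_{i\in V'}w_i\lambda_i-\max_{u\in S}\sum_{i\in V'}w_i\mu_iu_i .$$ Then for every $w\in\mathbb R_+^V$ and every $V'\subseteq V$, $$\sum_{i\in V'}w_i\,\mathbb E\{X_i\}\;\ge\;\frac12\max_{\emptyset\ne S\subseteq\Omega}D(w,V',S)\,\pi(S)\,\frac1{\Phi(S)} ,$$ where $1/\Phi(\Omega)=\infty$ and $0\cdot\infty=0$. -/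

import Mathlib

open scoped ENNReal

/-- A random-access network with interference graph `G` and fixed activation and de-activation
rates.  Node `i` receives packets as a Poisson process of rate `lam i`; its transmission times are
exponential with rate `mu i` and its back-off times exponential with rate `nu i`.  When a back-off
period ends the node starts transmitting with probability `phi i`; when a transmission ends the node
releases the medium with probability `psi i`.  The probabilities `phi i`, `psi i` do not depend on
the queue length. -/
structure FixedRateNetwork (V : Type*) where
  /-- the interference graph -/
  G : SimpleGraph V
  /-- arrival rates -/
  lam : V → ℝ
  /-- transmission (service) rates -/
  mu : V → ℝ
  /-- back-off rates -/
  nu : V → ℝ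
  /-- activation probabilities -/
  phi : V → ℝ
  /-- release probabilities -/
  psi : V → ℝ
  lam_pos : ∀ i, 0 < lam i
  mu_pos : ∀ i, 0 < mu i
  nu_pos : ∀ i, 0 < nu i
  phi_pos : ∀ i, 0 < phi i
  phi_le_one : ∀ i, phi i ≤ 1
  psi_pos : ∀ i, 0 < psi i
  psi_le_one : ∀ i, psi i ≤ 1

/-- A probability distribution `p` on a discrete state space is stationary for the transition
rates `q` when it satisfies the global balance equations: in every state the probability flow in
equals the probability flow out.  (A rate `q s s` belongs to a transition without effect; it
contributes equally to both sides.) -/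
def IsStationaryDistribution {X : Type*} (q : X → X → ℝ≥0∞) (p : PMF X) : Prop :=
  ∀ s, ∑' s', p s' * q s' s = p s * ∑' s', q s s'

noncomputable section

namespace FixedRateNetwork

variable {V : Type*}

/-- The set `Ω` of feasible joint activity states: a state is represented by the set of its active
nodes, which has to be an independent set of the interference graph. -/
abbrev Activity (net : FixedRateNetwork V) : Type _ :=
  {u : Finset V // net.G.IsIndepSet (u : Set V)}

/-- States of the joint process: an activity state together with the number of packets at each
node. -/
abbrev State (net : FixedRateNetwork V) : Type _ :=
  net.Activity × (V → ℕ)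

variable [Fintype V] [DecidableEq V]

instance instFintypeActivity (net : FixedRateNetwork V) : Fintype net.Activity :=
  Fintype.ofFinite _

/-- Transition rate of the joint process from `s = (u, x)` to `s' = (u', x')`, as the sum over the
nodes `i` of the rates of the events at node `i` that lead from `s` to `s'`:
* an arrival, at rate `lam i`, to `(u, x + e_i)`;
* an activation, at rate `nu i * phi i` if `u + e_i` is again feasible (that is, if neither `i` nor
  any of its neighbours is active in `u`), to `(u + e_i, x)`;
* if `i` is active, a transmission completion followed by another transmission, at rate
  `mu i * (1 - psi i)`, to `(u, x - e_i 1{x_i > 0})`;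
* if `i` is active, a transmission completion followed by a back-off period, at rate
  `mu i * psi i`, to `(u - e_i, x - e_i 1{x_i > 0})`.
Subtraction of natural numbers is truncated, so `x i - 1 = 0` if `x i = 0`. -/
def jointRate (net : FixedRateNetwork V) (s s' : net.State) : ℝ :=
  ∑ i : V,
    ((if s'.1 = s.1 ∧ s'.2 = Function.update s.2 i (s.2 i + 1) then net.lam i else 0)
    + (if i ∉ s.1.1 ∧ s'.1.1 = insert i s.1.1 ∧ s'.2 = s.2 then net.nu i * net.phi i else 0)
    + (if i ∈ s.1.1 ∧ s'.1 = s.1 ∧ s'.2 = Function.update s.2 i (s.2 i - 1)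
        then net.mu i * (1 - net.psi i) else 0)
    + (if i ∈ s.1.1 ∧ s'.1.1 = s.1.1.erase i ∧ s'.2 = Function.update s.2 i (s.2 i - 1)
        then net.mu i * net.psi i else 0))

/-- `p` is a stationary distribution of the joint process of activities and queue lengths. -/
def IsStationary (net : FixedRateNetwork V) (p : PMF net.State) : Prop :=
  IsStationaryDistribution (fun s s' => ENNReal.ofReal (net.jointRate s s')) p

/-- The transition rate `q(u, u')` of the activity process: `q(u, u + e_i) = nu i * phi i` and
`q(u + e_i, u) = mu i * psi i`. -/
def activityRate (net : FixedRateNetwork V) (u u' : net.Activity) : ℝ :=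
  ∑ i : V,
    ((if i ∉ u.1 ∧ u'.1 = insert i u.1 then net.nu i * net.phi i else 0)
    + (if i ∈ u.1 ∧ u'.1 = u.1.erase i then net.mu i * net.psi i else 0))

/-- The steady-state probability `π(u)` of the activity state `u`. -/
def activityProb (net : FixedRateNetwork V) (p : PMF net.State) (u : net.Activity) : ℝ :=
  (∑' x : V → ℕ, p (u, x)).toReal

/-- The steady-state probability `π(S)` of a set of activity states. -/
def setProb (net : FixedRateNetwork V) (p : PMF net.State) (S : Finset net.Activity) : ℝ :=
  ∑ u ∈ S, net.activityProb p u

open scoped Classical in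
/-- The steady-state transition rate `Q(S)` out of a set of activity states. -/
def exitFlow (net : FixedRateNetwork V) (p : PMF net.State) (S : Finset net.Activity) : ℝ :=
  ∑ u ∈ S, ∑ u' ∈ Sᶜ, net.activityProb p u * net.activityRate u u'

/-- The bottleneck ratio `Φ(S) = Q(S) / π(S)`. -/
def bottleneckRatio (net : FixedRateNetwork V) (p : PMF net.State)
    (S : Finset net.Activity) : ℝ :=
  net.exitFlow p S / net.setProb p S

/-- `Y(w, V', S)`: the maximum aggregate weighted service rate of the nodes in `V'` over the
activity states in the non-empty set `S`. -/
def maxServiceRate (net : FixedRateNetwork V) (w : V → ℝ) (V' : Finset V)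
    (S : Finset net.Activity) (hS : S.Nonempty) : ℝ :=
  S.sup' hS fun u => ∑ i ∈ V', w i * net.mu i * (if i ∈ u.1 then 1 else 0)

/-- `D(w, V', S)`: the minimum drift of the aggregate weighted queue length of the nodes in `V'`
while the activity state is in the non-empty set `S`. -/
def minDrift (net : FixedRateNetwork V) (w : V → ℝ) (V' : Finset V)
    (S : Finset net.Activity) (hS : S.Nonempty) : ℝ :=
  ∑ i ∈ V', w i * net.lam i - net.maxServiceRate w V' S hS

/-- The expected number of packets at node `i` under the distribution `p` (possibly infinite). -/
def meanQueue (net : FixedRateNetwork V) (p : PMF net.State) (i : V) : ℝ≥0∞ :=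
  ∑' s : net.State, p s * (s.2 i : ℝ≥0∞)

end FixedRateNetwork

end

open scoped ENNReal

set_option linter.unusedSectionVars false

/-! With fixed activation and release probabilities the activity process is autonomous and
reversible with respect to π, so the conditional means m(u) = E(X_i | U = u) solve a Poisson
equation for the activity generator itself (`gen_mean`). For a proper subset S let D_i solve the
Poisson equation on S with source λ_i - μ_i u_i and zero values outside: the drift of node i
accumulated until exit from S. Let g be the solution with source 1, the mean exit time. Symmetry of
the generator gives Σ_i w_i Σ_u π(u) D_i(u) ≥ D(w,V',S) Σ_u π(u) g(u), and a quadratic in the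
Dirichlet form gives Σ_u π(u) g(u) ≥ π(S)²/Q(S) = π(S)/Φ(S) (`sq_le_exit_mul`). The heart of the
proof is the remaining bound Σ_u π(u) D_i(u) ≤ 2 E X_i for a single node
(`sum_drift_le_two_mul_mean`).

For one queue put w = D - m + 1{active}. On S its generator is nonnegative and consists only of
service completions at an empty queue. The maximum principle gives w ≤ 1, hence D ≤ m on active
states and D ≤ m + w⁺ on inactive ones, so it suffices that Σ_inactive π w⁺ ≤ E X (`sum_le_mean`).
Let α be λ times the mean hitting time of the active states, and B_n = (w - P(X < n | U))⁺. Pairing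
with α and Young's inequality bound λ Σ_inactive π w⁺ by half the flow of α² plus half the flow of
B_1² across the active boundary. The first half is at most (λ/2) Σ_inactive π m, because α ≤ m
there. The second telescopes in n and is at most λ (Σ_active π m + ½ Σ_inactive π m)
(`flow_excess_le`); its factor ½ rests on w + P(X = n | U) ≤ 3/2 (`add_y_le`). The total is λ E X.

For S = Ω the drift is nonpositive when the relevant means are finite; an infinite mean with
positive weight makes the claim trivial. -/

/-- An irreducible reversible Markov chain on a finite state space. -/
structure ReversibleChain (Ω : Type*) where
  /-- the reversing measure -/
  weight : Ω → ℝ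
  /-- the transition rates -/
  rate : Ω → Ω → ℝ
  weight_pos : ∀ v, 0 < weight v
  rate_nonneg : ∀ v v', 0 ≤ rate v v'
  reversible : ∀ v v', weight v * rate v v' = weight v' * rate v' v
  irreducible : ∀ A : Set Ω, A.Nonempty → (∀ v ∈ A, ∀ v', 0 < rate v v' → v' ∈ A) → A = Set.univ

/-! ### Dirichlet form, maximum principle and Poisson equation of a finite reversible chain. -/

namespace ReversibleChain

variable {Ω : Type*} [Fintype Ω] (C : ReversibleChain Ω)

/-- The generator of the chain. -/
def gen (f : Ω → ℝ) (v : Ω) : ℝ := ∑ v', C.rate v v' * (f v' - f v)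

theorem gen_add (f g : Ω → ℝ) (v : Ω) :
    C.gen (fun v => f v + g v) v = C.gen f v + C.gen g v := by
  simp only [gen, ← Finset.sum_add_distrib]
  exact Finset.sum_congr rfl fun _ _ => by ring

theorem gen_sub (f g : Ω → ℝ) (v : Ω) :
    C.gen (fun v => f v - g v) v = C.gen f v - C.gen g v := by
  simp only [gen, ← Finset.sum_sub_distrib]
  exact Finset.sum_congr rfl fun _ _ => by ring

theorem gen_const_mul (c : ℝ) (f : Ω → ℝ) (v : Ω) :
    C.gen (fun v => c * f v) v = c * C.gen f v := by
  simp only [gen, Finset.mul_sum]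
  exact Finset.sum_congr rfl fun _ _ => by ring

theorem gen_sum {ι : Type*} (s : Finset ι) (f : ι → Ω → ℝ) (v : Ω) :
    C.gen (fun v => ∑ i ∈ s, f i v) v = ∑ i ∈ s, C.gen (f i) v := by
  simp only [gen]
  rw [Finset.sum_comm]
  refine Finset.sum_congr rfl fun _ _ => ?_
  rw [← Finset.sum_sub_distrib, Finset.mul_sum]

/-- Reversibility permits exchanging `v` and `v'` in the double sum; the average of the two versions
is the Dirichlet form. -/
theorem energy (f g : Ω → ℝ) :
    ∑ v, C.weight v * (g v * -C.gen f v) =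
      (1 / 2) * ∑ v, ∑ v', C.weight v * C.rate v v' * ((f v - f v') * (g v - g v')) := by
  have h1 : ∑ v, C.weight v * (g v * -C.gen f v) =
      ∑ v, ∑ v', C.weight v * C.rate v v' * (g v * (f v - f v')) := by
    refine Finset.sum_congr rfl fun v _ => ?_
    rw [gen, ← Finset.sum_neg_distrib, Finset.mul_sum, Finset.mul_sum]
    exact Finset.sum_congr rfl fun v' _ => by ring
  have h2 : ∑ v, ∑ v', C.weight v * C.rate v v' * (g v * (f v - f v')) =
      ∑ v, ∑ v', C.weight v * C.rate v v' * (g v' * (f v' - f v)) := by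
    rw [Finset.sum_comm]
    refine Finset.sum_congr rfl fun v _ => Finset.sum_congr rfl fun v' _ => ?_
    rw [C.reversible v' v]
  have h3 : ∑ v, ∑ v', C.weight v * C.rate v v' * ((f v - f v') * (g v - g v')) =
      ∑ v, ∑ v', C.weight v * C.rate v v' * (g v * (f v - f v')) +
      ∑ v, ∑ v', C.weight v * C.rate v v' * (g v' * (f v' - f v)) := by
    simp only [← Finset.sum_add_distrib]
    exact Finset.sum_congr rfl fun v _ => Finset.sum_congr rfl fun v' _ => by ring
  rw [h1, h3, ← h2]
  ring

theorem gen_symm (f g : Ω → ℝ) :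
    ∑ v, C.weight v * (g v * -C.gen f v) = ∑ v, C.weight v * (f v * -C.gen g v) := by
  rw [energy, energy]
  congr 1
  exact Finset.sum_congr rfl fun v _ => Finset.sum_congr rfl fun v' _ => by ring

theorem sum_weight_mul_gen (f : Ω → ℝ) : ∑ v, C.weight v * C.gen f v = 0 := by
  have h := C.energy f fun _ => 1
  simp only [one_mul, sub_self, mul_zero, Finset.sum_const_zero, mul_neg,
    Finset.sum_neg_distrib] at h
  linarith

/-- The maximum principle. -/
theorem le_of_subharmonic {A : Set Ω} (hA : A ≠ Set.univ) {f : Ω → ℝ} {M : ℝ}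
    (hf : ∀ v ∈ A, 0 ≤ C.gen f v) (hM : ∀ v ∉ A, f v ≤ M) (v : Ω) : f v ≤ M := by
  by_contra! hv
  obtain ⟨m, -, hm⟩ := Finset.exists_max_image Finset.univ f ⟨v, Finset.mem_univ v⟩
  have hmM : M < f m := hv.trans_le (hm v (Finset.mem_univ v))
  have key : ∀ x, f x = f m → x ∈ A := fun x hx => by
    by_contra hxA
    linarith [hM x hxA]
  -- At a maximiser in `A` subharmonicity forces every neighbour to be a maximiser, so
  -- irreducibility spreads the maximum over all of `Ω`, and hence `A` would be everything.
  have huniv := C.irreducible {x | f x = f m} ⟨m, rfl⟩ (by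
    intro x hx v' hv'
    have h0 := hf x (key x hx)
    have hle : ∀ z ∈ Finset.univ, C.rate x z * (f z - f x) ≤ 0 := fun z _ =>
      mul_nonpos_of_nonneg_of_nonpos (C.rate_nonneg x z) (by
        rw [show f x = f m from hx]; linarith [hm z (Finset.mem_univ z)])
    have h1 : ∑ z, C.rate x z * (f z - f x) = 0 := le_antisymm (Finset.sum_nonpos hle) h0
    have h2 := (Finset.sum_eq_zero_iff_of_nonpos hle).1 h1 v' (Finset.mem_univ v')
    rcases mul_eq_zero.1 h2 with h | h
    · exact absurd h hv'.ne'
    · change f v' = f m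
      rw [← show f x = f m from hx]; linarith)
  apply hA
  rw [Set.eq_univ_iff_forall]
  intro x
  exact key x (by rw [Set.eq_univ_iff_forall] at huniv; exact huniv x)

/-- Solvability of the Poisson equation on a proper subset with zero boundary values. -/
theorem exists_poisson {A : Set Ω} (hA : A ≠ Set.univ) (h : Ω → ℝ) :
    ∃ f : Ω → ℝ, (∀ v ∉ A, f v = 0) ∧ ∀ v ∈ A, -C.gen f v = h v := by
  classical
  let T : (Ω → ℝ) →ₗ[ℝ] (Ω → ℝ) :=
    { toFun := fun f v => if v ∈ A then -C.gen f v else f v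
      map_add' := fun f g => by
        funext v
        have := C.gen_add f g v
        by_cases hv : v ∈ A
        · simp only [hv, if_true, Pi.add_apply]
          rw [show C.gen (f + g) v = C.gen f v + C.gen g v from this]; ring
        · simp [hv]
      map_smul' := fun c f => by
        funext v
        have := C.gen_const_mul c f v
        by_cases hv : v ∈ A
        · simp only [hv, if_true, Pi.smul_apply, smul_eq_mul, RingHom.id_apply]
          rw [show C.gen (c • f) v = c * C.gen f v from this]; ring
        · simp [hv] }
  have hT : ∀ f v, T f v = if v ∈ A then -C.gen f v else f v := fun _ _ => rfl
  -- A kernel element is harmonic on `A` and zero off `A`; the maximum principle for `f` and `-f`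
  -- kills it. In finite dimension injectivity yields solvability.
  have hinj : Function.Injective T := by
    rw [← LinearMap.ker_eq_bot, LinearMap.ker_eq_bot']
    intro f hf
    have h1 : ∀ v ∈ A, C.gen f v = 0 := fun v hv => by
      have := congrFun hf v
      rw [hT, if_pos hv] at this
      simpa using this
    have h2 : ∀ v ∉ A, f v = 0 := fun v hv => by
      have := congrFun hf v
      rwa [hT, if_neg hv] at this
    have h3 : ∀ v, f v ≤ 0 :=
      C.le_of_subharmonic hA (fun v hv => (h1 v hv).ge) fun v hv => (h2 v hv).le
    have h4 : ∀ v, -1 * f v ≤ 0 := C.le_of_subharmonic hA (f := fun v => -1 * f v)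
      (fun v hv => by rw [gen_const_mul, h1 v hv]; simp) fun v hv => by simp [h2 v hv]
    funext v
    have := h3 v
    have := h4 v
    simp only [Pi.zero_apply]
    linarith
  obtain ⟨f, hf⟩ := LinearMap.injective_iff_surjective.1 hinj fun v => if v ∈ A then h v else 0
  refine ⟨f, fun v hv => ?_, fun v hv => ?_⟩
  · have := congrFun hf v
    rwa [hT, if_neg hv, if_neg hv] at this
  · have := congrFun hf v
    rwa [hT, if_pos hv, if_pos hv] at this

variable [DecidableEq Ω]

/-- The contribution of the transitions between `Aᶜ` and `A` to a symmetric form. -/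
theorem half_sum_ge_cross (A : Finset Ω) {t : Ω → Ω → ℝ} (hs : ∀ v v', t v v' = t v' v)
    (ht : ∀ v v', (v ∈ A ↔ v' ∈ A) → 0 ≤ t v v') :
    ∑ v ∈ Aᶜ, ∑ v' ∈ A, t v v' ≤ (1 / 2) * ∑ v, ∑ v', t v v' := by
  have h1 : ∑ v, ∑ v', t v v' =
      (∑ v ∈ A, ∑ v' ∈ A, t v v' + ∑ v ∈ A, ∑ v' ∈ Aᶜ, t v v') +
      (∑ v ∈ Aᶜ, ∑ v' ∈ A, t v v' + ∑ v ∈ Aᶜ, ∑ v' ∈ Aᶜ, t v v') := by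
    rw [← Finset.sum_add_distrib, ← Finset.sum_add_distrib, ← Finset.sum_add_sum_compl A]
    simp only [Finset.sum_add_sum_compl]
  have h2 : ∑ v ∈ A, ∑ v' ∈ Aᶜ, t v v' = ∑ v ∈ Aᶜ, ∑ v' ∈ A, t v v' := by
    rw [Finset.sum_comm]
    exact Finset.sum_congr rfl fun _ _ => Finset.sum_congr rfl fun _ _ => hs _ _
  have h3 : 0 ≤ ∑ v ∈ A, ∑ v' ∈ A, t v v' := Finset.sum_nonneg fun v hv =>
    Finset.sum_nonneg fun v' hv' => ht _ _ (by simp [hv, hv'])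
  have h4 : 0 ≤ ∑ v ∈ Aᶜ, ∑ v' ∈ Aᶜ, t v v' := Finset.sum_nonneg fun v hv =>
    Finset.sum_nonneg fun v' hv' => ht _ _ (by simp_all)
  rw [h1, h2]
  linarith

/-- The stationary mean exit time from `S` is at least `π(S)² / Q(S)`. -/
theorem sq_le_exit_mul (S : Finset Ω) {g : Ω → ℝ} (hg : ∀ v ∉ S, g v = 0)
    (hg1 : ∀ v ∈ S, -C.gen g v = 1) :
    (∑ v ∈ S, C.weight v) ^ 2 ≤
      (∑ v ∈ S, ∑ v' ∈ Sᶜ, C.weight v * C.rate v v') * ∑ v, C.weight v * g v := by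
  set P := ∑ v ∈ S, C.weight v
  set Q := ∑ v ∈ S, ∑ v' ∈ Sᶜ, C.weight v * C.rate v v' with hQ
  let I : Ω → ℝ := fun v => if v ∈ S then 1 else 0
  have hP : ∑ v, C.weight v * (I v * -C.gen g v) = P := by
    rw [← Finset.sum_subset (Finset.subset_univ S)]
    · exact Finset.sum_congr rfl fun v hv => by simp [I, hv, hg1 v hv]
    · intro v _ hv; simp [I, hv]
  have hG : ∑ v, C.weight v * (g v * -C.gen g v) = ∑ v, C.weight v * g v := by
    refine Finset.sum_congr rfl fun v _ => ?_
    by_cases hv : v ∈ S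
    · rw [hg1 v hv]; ring
    · rw [hg v hv]; ring
  have hI : ∑ v, C.weight v * (I v * -C.gen I v) = Q := by
    rw [← Finset.sum_subset (Finset.subset_univ S)]
    · refine Finset.sum_congr rfl fun v hv => ?_
      rw [gen, ← Finset.sum_add_sum_compl S, Finset.sum_eq_zero (s := S), zero_add,
        ← Finset.sum_neg_distrib, Finset.mul_sum, Finset.mul_sum]
      · refine Finset.sum_congr rfl fun v' hv' => ?_
        simp [I, hv, Finset.mem_compl.1 hv']
      · intro v' hv'; simp [I, hv, hv']
    · intro v _ hv; simp [I, hv]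
  -- The quadratic is the Dirichlet form of `g - t * I`: its coefficients are the forms of (I, I),
  -- (g, I) and (g, g). Nonnegativity for all `t` bounds the discriminant.
  have key : ∀ t : ℝ, 0 ≤ Q * (t * t) + (-2 * P) * t + ∑ v, C.weight v * g v := by
    intro t
    have h0 : 0 ≤ ∑ v, C.weight v * ((g v - t * I v) * -C.gen (fun v => g v - t * I v) v) := by
      rw [energy]
      refine mul_nonneg (by norm_num) (Finset.sum_nonneg fun v _ => Finset.sum_nonneg fun v' _ =>
        mul_nonneg (mul_nonneg (C.weight_pos v).le (C.rate_nonneg v v')) (mul_self_nonneg _))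
    have h1 : ∑ v, C.weight v * ((g v - t * I v) * -C.gen (fun v => g v - t * I v) v) =
        ∑ v, C.weight v * (g v * -C.gen g v) - t * ∑ v, C.weight v * (I v * -C.gen g v)
        - t * ∑ v, C.weight v * (g v * -C.gen I v)
        + t * t * ∑ v, C.weight v * (I v * -C.gen I v) := by
      simp only [Finset.mul_sum, ← Finset.sum_sub_distrib, ← Finset.sum_add_distrib]
      refine Finset.sum_congr rfl fun v _ => ?_
      rw [gen_sub, gen_const_mul]; ring
    rw [h1, hG, hP, C.gen_symm I g, hP, hI] at h0
    linarith
  have := discrim_le_zero key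
  rw [discrim] at this
  nlinarith

end ReversibleChain

/-! ### A single queue modulated by a reversible chain. -/

/-- The conditional queue length distributions `y n v = P(X = n | U = v)` of a queue with Poisson
arrivals of rate `lam`, whose server state is governed by the chain `C`.  The server is active in
the states of `act`, where it completes services at rate `kap`; every transition from an active to
an inactive state completes a service as well.  The `cut` equations balance the flows into and out
of the sets `{U = v, X ≤ n}`; `mean v` is the conditional mean queue length. -/
structure ModulatedQueue {Ω : Type*} [Fintype Ω] [DecidableEq Ω] (C : ReversibleChain Ω) where
  /-- the states in which the server is active -/
  act : Finset Ω
  /-- the arrival rate -/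
  lam : ℝ
  /-- the rate of service completions without release -/
  kap : ℝ
  /-- the rate of service completions with release -/
  rel : ℝ
  /-- the conditional queue length distributions -/
  y : ℕ → Ω → ℝ
  /-- the conditional mean queue lengths -/
  mean : Ω → ℝ
  lam_pos : 0 < lam
  kap_nonneg : 0 ≤ kap
  release_rate : ∀ v ∈ act, ∑ v' ∈ actᶜ, C.rate v v' = rel
  y_nonneg : ∀ n v, 0 ≤ y n v
  -- A release flow π(v') q(v',v) into an inactive `v`, divided by π(v), is q(v,v') by
  -- reversibility; this is why the rates point from `v` to `v'`.
  cut : ∀ n v, lam * y n v = C.gen (fun v => ∑ k ∈ Finset.range (n + 1), y k v) v +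
    if v ∈ act then kap * y (n + 1) v else ∑ v' ∈ act, C.rate v v' * y (n + 1) v'
  hasSum_tail : ∀ v, HasSum (fun n => 1 - ∑ k ∈ Finset.range (n + 1), y k v) (mean v)

namespace ModulatedQueue

variable {Ω : Type*} [Fintype Ω] [DecidableEq Ω] {C : ReversibleChain Ω} (q : ModulatedQueue C)

/-- The conditional probability of fewer than `n` packets. -/
def cdf (n : ℕ) (v : Ω) : ℝ := ∑ k ∈ Finset.range n, q.y k v

/-- The weight that the service completions give to a function `f`. -/
def served (f : Ω → ℝ) (v : Ω) : ℝ :=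
  if v ∈ q.act then q.kap * f v else ∑ v' ∈ q.act, C.rate v v' * f v'

/-- The indicator function of the active states. -/
def active (v : Ω) : ℝ := if v ∈ q.act then 1 else 0

theorem cdf_succ (n : ℕ) (v : Ω) : q.cdf (n + 1) v = q.cdf n v + q.y n v :=
  Finset.sum_range_succ _ _

theorem cdf_nonneg (n : ℕ) (v : Ω) : 0 ≤ q.cdf n v :=
  Finset.sum_nonneg fun k _ => q.y_nonneg k v

theorem gen_cdf (n : ℕ) (v : Ω) :
    C.gen (q.cdf (n + 1)) v = q.lam * q.y n v - q.served (q.y (n + 1)) v := by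
  have := q.cut n v
  simp only [served]
  change C.gen (fun v => ∑ k ∈ Finset.range (n + 1), q.y k v) v = _
  linarith

theorem hasSum_one_sub_cdf (v : Ω) : HasSum (fun n => 1 - q.cdf (n + 1) v) (q.mean v) :=
  q.hasSum_tail v

theorem tendsto_cdf (v : Ω) :
    Filter.Tendsto (fun n => q.cdf (n + 1) v) Filter.atTop (nhds 1) := by
  have h := (q.hasSum_one_sub_cdf v).summable.tendsto_atTop_zero
  have h1 := (tendsto_const_nhds (x := (1 : ℝ)) (f := Filter.atTop (α := ℕ))).sub h
  simpa using h1

theorem hasSum_y (v : Ω) : HasSum (fun n => q.y n v) 1 := by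
  rw [hasSum_iff_tendsto_nat_of_nonneg fun n => q.y_nonneg n v]
  exact (Filter.tendsto_add_atTop_iff_nat 1).1 (q.tendsto_cdf v)

theorem cdf_le_one (n : ℕ) (v : Ω) : q.cdf n v ≤ 1 :=
  sum_le_hasSum _ (fun k _ => q.y_nonneg k v) (q.hasSum_y v)

theorem y_le_one (n : ℕ) (v : Ω) : q.y n v ≤ 1 := by
  have h1 := q.cdf_succ n v
  have h2 := q.cdf_nonneg n v
  have h3 := q.cdf_le_one (n + 1) v
  linarith

theorem y_add_y_le_one {j k : ℕ} (h : j ≠ k) (v : Ω) : q.y j v + q.y k v ≤ 1 := by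
  have := sum_le_hasSum {j, k} (fun k _ => q.y_nonneg k v) (q.hasSum_y v)
  rwa [Finset.sum_pair h] at this

theorem one_sub_y_zero_le_mean (v : Ω) : 1 - q.y 0 v ≤ q.mean v := by
  have := le_hasSum (q.hasSum_one_sub_cdf v) 0 fun n _ => by linarith [q.cdf_le_one (n + 1) v]
  simpa [cdf] using this

theorem mean_nonneg (v : Ω) : 0 ≤ q.mean v := by
  linarith [q.one_sub_y_zero_le_mean v, q.y_le_one 0 v]

/-- Sum the `cut` equations over all levels: the tails add up to the mean, and level 0 is the only
one missing from the service terms. -/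
theorem gen_mean (v : Ω) :
    -C.gen q.mean v = q.lam - q.served (fun v => 1 - q.y 0 v) v := by
  have h1 : HasSum (fun n => C.gen (q.cdf (n + 1)) v) (-C.gen q.mean v) := by
    simp only [ReversibleChain.gen, ← Finset.sum_neg_distrib]
    refine hasSum_sum fun v' _ => ?_
    have := ((q.hasSum_one_sub_cdf v).sub (q.hasSum_one_sub_cdf v')).mul_left (C.rate v v')
    rw [show -(C.rate v v' * (q.mean v' - q.mean v)) = C.rate v v' * (q.mean v - q.mean v') by ring]
    exact this.congr_fun fun n => by ring
  have hy : ∀ v, HasSum (fun n => q.y (n + 1) v) (1 - q.y 0 v) := fun v => by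
    have := (hasSum_nat_add_iff' 1).2 (q.hasSum_y v)
    simpa using this
  have h2 : HasSum (fun n => q.served (q.y (n + 1)) v) (q.served (fun v => 1 - q.y 0 v) v) := by
    unfold served
    split_ifs
    · exact (hy v).mul_left _
    · exact hasSum_sum fun v' _ => (hy v').mul_left _
  have h3 := ((q.hasSum_y v).mul_left q.lam).sub h2
  rw [mul_one] at h3
  exact h1.unique (by simpa only [gen_cdf] using h3)

/-- Used to trade the release rate at active states for the reversed release flow at inactive ones,
which is how `served` counts releases. -/
theorem gen_active (v : Ω) :
    -C.gen q.active v = if v ∈ q.act then q.rel else -∑ v' ∈ q.act, C.rate v v' := by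
  rw [ReversibleChain.gen, ← Finset.sum_add_sum_compl q.act]
  split_ifs with hv
  · rw [Finset.sum_eq_zero (s := q.act), zero_add, ← Finset.sum_neg_distrib,
      ← q.release_rate v hv]
    · refine Finset.sum_congr rfl fun v' hv' => ?_
      simp [active, hv, Finset.mem_compl.1 hv']
    · intro v' hv'; simp [active, hv, hv']
  · rw [Finset.sum_eq_zero (s := q.actᶜ), add_zero]
    · congr 1
      refine Finset.sum_congr rfl fun v' hv' => ?_
      simp [active, hv, hv']
    · intro v' hv'; simp [active, hv, Finset.mem_compl.1 hv']

/-- The total flow, weighted by `h`, from inactive to active states. -/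
def flow (h : Ω → Ω → ℝ) : ℝ :=
  ∑ v ∈ q.actᶜ, ∑ v' ∈ q.act, C.weight v * C.rate v v' * h v v'

theorem flow_mono {h k : Ω → Ω → ℝ} (hk : ∀ v ∉ q.act, ∀ v' ∈ q.act, h v v' ≤ k v v') :
    q.flow h ≤ q.flow k :=
  Finset.sum_le_sum fun v hv => Finset.sum_le_sum fun v' hv' =>
    mul_le_mul_of_nonneg_left (hk v (Finset.mem_compl.1 hv) v' hv')
      (mul_nonneg (C.weight_pos v).le (C.rate_nonneg v v'))

theorem flow_add (h k : Ω → Ω → ℝ) :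
    q.flow (fun v v' => h v v' + k v v') = q.flow h + q.flow k := by
  simp only [flow, mul_add, Finset.sum_add_distrib]

theorem flow_const_mul (c : ℝ) (h : Ω → Ω → ℝ) :
    q.flow (fun v v' => c * h v v') = c * q.flow h := by
  simp only [flow, Finset.mul_sum]
  exact Finset.sum_congr rfl fun _ _ => Finset.sum_congr rfl fun _ _ => by ring

/-- Transitions inside the active or inside the inactive set contribute nonnegatively and are
dropped; crossing pairs occur twice, which cancels the factor 1/2. Crossing terms need no sign. -/
theorem flow_le_energy {f g : Ω → ℝ}
    (hfg : ∀ v v', (v ∈ q.act ↔ v' ∈ q.act) → 0 ≤ (f v - f v') * (g v - g v')) :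
    q.flow (fun v v' => (f v - f v') * (g v - g v')) ≤
      ∑ v, C.weight v * (g v * -C.gen f v) := by
  rw [C.energy]
  refine ReversibleChain.half_sum_ge_cross q.act
    (t := fun v v' => C.weight v * C.rate v v' * ((f v - f v') * (g v - g v')))
    (fun v v' => ?_) fun v v' h => ?_
  · simp only [C.reversible v v']; ring
  · exact mul_nonneg (mul_nonneg (C.weight_pos v).le (C.rate_nonneg v v')) (hfg v v' h)

/-! ### The loss function and its pointwise bounds. -/

/-- A function that grows no faster than the loss of the comparison argument: it is subharmonic
with the given source inside `S`, and bounded by the probability of an empty queue outside. -/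
structure IsLoss (S : Finset Ω) (w : Ω → ℝ) : Prop where
  ne_univ : S ≠ Finset.univ
  gen_eq : ∀ v ∈ S, C.gen w v = q.served (q.y 0) v
  boundary_act : ∀ v ∉ S, v ∈ q.act → w v ≤ q.y 0 v
  boundary_inact : ∀ v ∉ S, v ∉ q.act → w v ≤ 0

variable {q} {S : Finset Ω} {w : Ω → ℝ}

theorem served_nonneg {f : Ω → ℝ} (hf : ∀ v, 0 ≤ f v) (v : Ω) : 0 ≤ q.served f v := by
  unfold served
  split_ifs
  · exact mul_nonneg q.kap_nonneg (hf v)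
  · exact Finset.sum_nonneg fun v' _ => mul_nonneg (C.rate_nonneg v v') (hf v')

namespace IsLoss

theorem coe_ne_univ (h : q.IsLoss S w) : (S : Set Ω) ≠ Set.univ := by
  simpa using h.ne_univ

theorem le_one (h : q.IsLoss S w) (v : Ω) : w v ≤ 1 := by
  refine C.le_of_subharmonic h.coe_ne_univ (fun v hv => ?_) (fun v hv => ?_) v
  · rw [h.gen_eq v hv]
    exact served_nonneg (q.y_nonneg 0) v
  · by_cases hva : v ∈ q.act
    · exact (h.boundary_act v hv hva).trans (q.y_le_one 0 v)
    · exact (h.boundary_inact v hv hva).trans zero_le_one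

/-- A maximum principle on pairs (level, state), with level 0 excluded at active states. A maximum
above 3/2 would put more than half of the conditional mass on one level, and then the balance
equations contradict maximality. -/
theorem add_y_le (h : q.IsLoss S w) (k : ℕ) (v : Ω) (hk : v ∈ q.act → 1 ≤ k) :
    w v + q.y k v ≤ 3 / 2 := by
  by_contra! hbad
  -- Since `w ≤ 1`, levels with `y ≤ 1/2` cannot violate the bound, so the maximum over a finite
  -- range of levels is global.
  have hK : ∃ K, ∀ k ≥ K, ∀ v, q.y k v ≤ 1 / 2 := by
    have : ∀ v, ∀ᶠ k in Filter.atTop, q.y k v ≤ 1 / 2 := fun v =>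
      ((q.hasSum_y v).summable.tendsto_atTop_zero).eventually_le_const (by norm_num)
    exact Filter.eventually_atTop.1 (Filter.eventually_all.2 this)
  obtain ⟨K, hK⟩ := hK
  have hlt : ∀ k v, 3 / 2 < w v + q.y k v → k < K := fun k v hkv => by
    by_contra! hle
    linarith [hK k hle v, h.le_one v]
  set T := (Finset.range K ×ˢ (Finset.univ : Finset Ω)).filter
    fun z => z.2 ∈ q.act → 1 ≤ z.1 with hT
  obtain ⟨⟨m, x⟩, hmx, hmax⟩ := Finset.exists_max_image T (fun z => w z.2 + q.y z.1 z.2)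
    ⟨(k, v), by simp only [hT, Finset.mem_filter, Finset.mem_product, Finset.mem_range,
      Finset.mem_univ, and_true]; exact ⟨hlt k v hbad, hk⟩⟩
  have hm : x ∈ q.act → 1 ≤ m := (Finset.mem_filter.1 hmx).2
  simp only at hmax
  set M := w x + q.y m x with hM
  have hM32 : 3 / 2 < M := hbad.trans_le (hmax (k, v) (by
    simp only [hT, Finset.mem_filter, Finset.mem_product, Finset.mem_range,
      Finset.mem_univ, and_true]; exact ⟨hlt k v hbad, hk⟩))
  have hall : ∀ k v, (v ∈ q.act → 1 ≤ k) → w v + q.y k v ≤ M := fun k v hk => by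
    by_cases hkK : k < K
    · exact hmax (k, v) (by
        simp only [hT, Finset.mem_filter, Finset.mem_product, Finset.mem_range,
          Finset.mem_univ, and_true]; exact ⟨hkK, hk⟩)
    · linarith [hK k (not_lt.1 hkK) v, h.le_one v]
  have hy : 1 / 2 < q.y m x := by linarith [h.le_one x]
  have hxS : x ∈ S := by
    by_contra hxS
    by_cases hxa : x ∈ q.act
    · have := h.boundary_act x hxS hxa
      have := q.y_add_y_le_one (show 0 ≠ m by have := hm hxa; omega) x
      linarith
    · linarith [h.boundary_inact x hxS hxa, q.y_le_one m x]
  have hgen : C.gen (fun v => w v + q.y m v) x =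
      q.served (q.y 0) x + C.gen (q.y m) x := by
    rw [C.gen_add, h.gen_eq x hxS]
  have hgen0 : C.gen (q.y 0) x = q.lam * q.y 0 x - q.served (q.y 1) x := by
    have : q.cdf (0 + 1) = q.y 0 := by funext v; simp [cdf]
    rw [← this, q.gen_cdf]; simp [cdf]
  have hgen1 : ∀ j, C.gen (q.y (j + 1)) x = q.lam * q.y (j + 1) x - q.served (q.y (j + 2)) x
      - (q.lam * q.y j x - q.served (q.y (j + 1)) x) := fun j => by
    rw [← q.gen_cdf, ← q.gen_cdf, ← C.gen_sub]
    congr 1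
    funext v
    rw [q.cdf_succ (j + 1)]; ring
  by_cases hxa : x ∈ q.act
  · obtain ⟨j, rfl⟩ : ∃ j, m = j + 1 := ⟨m - 1, by have := hm hxa; omega⟩
    have hle : C.gen (fun v => w v + q.y (j + 1) v) x ≤ 0 :=
      Finset.sum_nonpos fun v' _ => mul_nonpos_of_nonneg_of_nonpos (C.rate_nonneg x v')
        (by linarith [hall (j + 1) v' fun _ => by omega])
    rw [hgen, hgen1] at hle
    simp only [served, hxa, if_true] at hle
    have h1 := q.y_add_y_le_one (show j ≠ j + 1 by omega) x
    have h2 := q.y_add_y_le_one (show j + 1 ≠ j + 2 by omega) x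
    have h3 : 0 < q.lam * (q.y (j + 1) x - q.y j x) := mul_pos q.lam_pos (by linarith)
    have h4 : 0 ≤ q.kap * (q.y (j + 1) x - q.y (j + 2) x) :=
      mul_nonneg q.kap_nonneg (by linarith)
    have h5 : 0 ≤ q.kap * q.y 0 x := mul_nonneg q.kap_nonneg (q.y_nonneg 0 x)
    linarith
  · have hle : C.gen (fun v => w v + q.y m v) x ≤
        ∑ v' ∈ q.act, C.rate x v' * (w v' + q.y m v' - M) := by
      rw [ReversibleChain.gen, ← Finset.sum_add_sum_compl q.act]
      have : ∑ v' ∈ q.actᶜ, C.rate x v' * (w v' + q.y m v' - (w x + q.y m x)) ≤ 0 :=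
        Finset.sum_nonpos fun v' hv' => mul_nonpos_of_nonneg_of_nonpos (C.rate_nonneg x v')
          (by linarith [hall m v' fun ha => absurd ha (Finset.mem_compl.1 hv')])
      linarith
    rw [hgen] at hle
    -- At active states the comparison uses level `m + 1`, since `m` may be 0, which is not
    -- admissible there.
    have hnext : ∑ v' ∈ q.act, C.rate x v' * (w v' + q.y m v' - M) ≤
        ∑ v' ∈ q.act, C.rate x v' * (q.y m v' - q.y (m + 1) v') :=
      Finset.sum_le_sum fun v' _ => mul_le_mul_of_nonneg_left
        (by linarith [hall (m + 1) v' fun _ => by omega]) (C.rate_nonneg x v')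
    have h0 : 0 ≤ ∑ v' ∈ q.act, C.rate x v' * q.y 0 v' :=
      Finset.sum_nonneg fun v' _ => mul_nonneg (C.rate_nonneg x v') (q.y_nonneg 0 v')
    have hsplit : ∑ v' ∈ q.act, C.rate x v' * (q.y m v' - q.y (m + 1) v') =
        ∑ v' ∈ q.act, C.rate x v' * q.y m v' - ∑ v' ∈ q.act, C.rate x v' * q.y (m + 1) v' := by
      simp only [mul_sub, Finset.sum_sub_distrib]
    rw [hsplit] at hnext
    rcases m with _ | j
    · rw [hgen0] at hle
      simp only [served, hxa, if_false] at hle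
      have : 0 < q.lam * q.y 0 x := mul_pos q.lam_pos (by linarith)
      simp only [zero_add] at *
      linarith
    · rw [hgen1] at hle
      simp only [served, hxa, if_false] at hle
      have h1 := q.y_add_y_le_one (show j ≠ j + 1 by omega) x
      have h3 : 0 < q.lam * (q.y (j + 1) x - q.y j x) := mul_pos q.lam_pos (by linarith)
      have : j + 1 + 1 = j + 2 := rfl
      rw [this] at hnext
      linarith

end IsLoss

/-! ### Truncated losses and the telescoping flow estimate. -/

variable (q w) in
/-- The part of the loss that exceeds the probability of fewer than `n` packets. -/
def excess (n : ℕ) (v : Ω) : ℝ := max (w v - q.cdf n v) 0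

theorem excess_nonneg (n : ℕ) (v : Ω) : 0 ≤ q.excess w n v := le_max_right _ _

namespace IsLoss

theorem excess_le (h : q.IsLoss S w) (n : ℕ) (v : Ω) : q.excess w n v ≤ 1 - q.cdf n v :=
  max_le (by linarith [h.le_one v]) (by linarith [q.cdf_le_one n v])

/-- The index `n + 1` matters: `cdf (n + 1)` contains `y 0`, which dominates the boundary values of
`w`. -/
theorem excess_eq_zero (h : q.IsLoss S w) (n : ℕ) {v : Ω} (hv : v ∉ S) :
    q.excess w (n + 1) v = 0 := by
  refine max_eq_right ?_
  have h1 : q.y 0 v ≤ q.cdf (n + 1) v :=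
    Finset.single_le_sum (f := fun k => q.y k v) (fun k _ => q.y_nonneg k v)
      (Finset.mem_range.2 n.succ_pos)
  by_cases hva : v ∈ q.act
  · linarith [h.boundary_act v hv hva]
  · linarith [h.boundary_inact v hv hva, q.cdf_nonneg (n + 1) v]

/-- For y = `y n v` ≤ 1/2 this is `excess_le`. For y > 1/2 and positive excess, `add_y_le` makes the
right side exceed the left by at least 2(y - 1/2)² + A(y - 1/2), where A = `cdf n v`. -/
theorem y_mul_excess_le_half (h : q.IsLoss S w) (n : ℕ) {v : Ω} (hv : v ∉ q.act) :
    q.y n v * q.excess w (n + 1) v ≤ (1 / 2) * (1 - q.cdf (n + 1) v) := by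
  have hT := q.cdf_le_one (n + 1) v
  have hy0 := q.y_nonneg n v
  by_cases hy : q.y n v ≤ 1 / 2
  · exact mul_le_mul hy (h.excess_le _ v) (excess_nonneg _ _) (by norm_num)
  · push Not at hy
    have hA := q.cdf_nonneg n v
    have h32 := h.add_y_le n v fun ha => absurd ha hv
    have hs := q.cdf_succ n v
    rw [excess]
    rcases le_total (w v - q.cdf (n + 1) v) 0 with h0 | h0
    · rw [max_eq_right h0, mul_zero]; linarith
    · rw [max_eq_left h0]
      have h1 : q.y n v * (w v - q.cdf (n + 1) v) ≤
          q.y n v * (3 / 2 - 2 * q.y n v - q.cdf n v) :=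
        mul_le_mul_of_nonneg_left (by linarith) hy0
      rw [hs]
      nlinarith [sq_nonneg (q.y n v - 1 / 2)]

theorem y_mul_excess_le (h : q.IsLoss S w) (n : ℕ) (v : Ω) :
    q.y n v * q.excess w (n + 1) v ≤ 1 - q.cdf (n + 1) v := by
  have := mul_le_mul (q.y_le_one n v) (h.excess_le (n + 1) v) (excess_nonneg _ _) zero_le_one
  linarith

theorem sum_y_mul_excess_le (h : q.IsLoss S w) (N : ℕ) (v : Ω) :
    ∑ n ∈ Finset.range N, q.y n v * q.excess w (n + 1) v ≤
      (if v ∈ q.act then 1 else 1 / 2) * q.mean v := by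
  have h1 : ∑ n ∈ Finset.range N, (1 - q.cdf (n + 1) v) ≤ q.mean v :=
    sum_le_hasSum _ (fun n _ => by linarith [q.cdf_le_one (n + 1) v]) (q.hasSum_one_sub_cdf v)
  split_ifs with hv
  · rw [one_mul]
    exact (Finset.sum_le_sum fun n _ => h.y_mul_excess_le n v).trans h1
  · refine (Finset.sum_le_sum fun n _ => h.y_mul_excess_le_half n hv).trans ?_
    rw [← Finset.mul_sum]
    linarith

/-- Pair -gen f, for f = w - cdf (n+1), with its positive part. The arrival term is the right side;
the service terms, together with the crossing part of the Dirichlet form, dominate the difference of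
flows. -/
theorem flow_excess_sub_le (h : q.IsLoss S w) (n : ℕ) :
    (1 / 2) * q.flow (fun _ v' => q.excess w (n + 1) v' ^ 2) -
      (1 / 2) * q.flow (fun _ v' => q.excess w (n + 2) v' ^ 2) ≤
      q.lam * ∑ v, C.weight v * (q.y n v * q.excess w (n + 1) v) := by
  set f : Ω → ℝ := fun v => w v - q.cdf (n + 1) v with hf
  set B := q.excess w (n + 1) with hB
  have hBf : ∀ v, B v = max (f v) 0 := fun _ => rfl
  have h1 : q.flow (fun v v' => (f v - f v') * (B v - B v')) ≤
      ∑ v, C.weight v * (B v * -C.gen f v) := by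
    refine q.flow_le_energy fun v v' _ => ?_
    rw [hBf, hBf]
    rcases le_total (f v) (f v') with h0 | h0
    · exact mul_nonneg_of_nonpos_of_nonpos (by linarith)
        (by linarith [max_le_max_right (0 : ℝ) h0])
    · exact mul_nonneg (by linarith) (by linarith [max_le_max_right (0 : ℝ) h0])
  have h2 : ∑ v, C.weight v * (B v * -C.gen f v) ≤
      q.lam * ∑ v, C.weight v * (q.y n v * B v) -
        q.flow fun v v' => B v * (q.y 0 v' + q.y (n + 1) v') := by
    rw [flow, Finset.mul_sum, ← Finset.sum_add_sum_compl q.act,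
      ← Finset.sum_add_sum_compl q.act, add_sub_assoc, ← Finset.sum_sub_distrib]
    have hgen : ∀ v, v ∈ S → -C.gen f v =
        q.lam * q.y n v - q.served (q.y (n + 1)) v - q.served (q.y 0) v := fun v hv => by
      rw [hf, C.gen_sub, h.gen_eq v hv, ← q.gen_cdf]; ring
    -- At active states the service terms have a favourable sign and are discarded; at inactive
    -- states they are exactly the subtracted flow.
    refine add_le_add (Finset.sum_le_sum fun v hv => ?_) (Finset.sum_le_sum fun v hv => ?_)
    · by_cases hvS : v ∈ S
      · have e1 := served_nonneg (q := q) (q.y_nonneg (n + 1)) v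
        have e2 := served_nonneg (q := q) (q.y_nonneg 0) v
        have e3 : B v * -C.gen f v ≤ B v * (q.lam * q.y n v) :=
          mul_le_mul_of_nonneg_left (by rw [hgen v hvS]; linarith) (excess_nonneg _ _)
        have := mul_le_mul_of_nonneg_left e3 (C.weight_pos v).le
        linarith
      · rw [show B v = 0 from h.excess_eq_zero n hvS]; simp
    · by_cases hvS : v ∈ S
      · rw [hgen v hvS]
        simp only [served, Finset.mem_compl.1 hv, if_false]
        have : ∑ v' ∈ q.act, C.weight v * C.rate v v' * (B v * (q.y 0 v' + q.y (n + 1) v')) =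
            C.weight v * B v * (∑ v' ∈ q.act, C.rate v v' * q.y 0 v' +
              ∑ v' ∈ q.act, C.rate v v' * q.y (n + 1) v') := by
          rw [← Finset.sum_add_distrib, Finset.mul_sum]
          exact Finset.sum_congr rfl fun _ _ => by ring
        rw [this]
        exact le_of_eq (by ring)
      · rw [show B v = 0 from h.excess_eq_zero n hvS]; simp
  have h3 : q.flow (fun v v' => (1 / 2) * B v' ^ 2 + -(1 / 2) * q.excess w (n + 2) v' ^ 2) ≤
      q.flow fun v v' => (f v - f v') * (B v - B v') + B v * (q.y 0 v' + q.y (n + 1) v') := by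
    refine q.flow_mono fun v _ v' _ => ?_
    have hB2 : q.excess w (n + 2) v' = max (f v' - q.y (n + 1) v') 0 := by
      simp only [excess, hf]
      rw [q.cdf_succ (n + 1)]
      congr 1; ring
    set b := q.excess w (n + 2) v'
    have e1 : 0 ≤ B v := excess_nonneg _ _
    have e2 : 0 ≤ B v' := excess_nonneg _ _
    have e3 : f v' - q.y (n + 1) v' ≤ b := by rw [hB2]; exact le_max_left _ _
    have e4 : f v ≤ B v := le_max_left _ _
    have e5 : f v * B v = B v ^ 2 := by
      rw [hBf]
      rcases le_total (f v) 0 with h0 | h0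
      · rw [max_eq_right h0]; ring
      · rw [max_eq_left h0]; ring
    have e6 : f v' * B v' = B v' ^ 2 := by
      rw [hBf]
      rcases le_total (f v') 0 with h0 | h0
      · rw [max_eq_right h0]; ring
      · rw [max_eq_left h0]; ring
    have e7 := mul_le_mul_of_nonneg_left e3 e1
    have e8 := mul_le_mul_of_nonneg_right e4 e2
    have e9 := mul_nonneg e1 (q.y_nonneg 0 v')
    -- The surplus is at least ½(B v - B v')² + ½(B v - b)².
    nlinarith [sq_nonneg (B v - B v'), sq_nonneg (B v - b)]
  rw [flow_add, flow_add, flow_const_mul, flow_const_mul] at h3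
  linarith

/-- Telescope over the levels; the last flow vanishes in the limit because the excess is at most the
tail `1 - cdf`. -/
theorem flow_excess_le (h : q.IsLoss S w) :
    (1 / 2) * q.flow (fun _ v' => q.excess w 1 v' ^ 2) ≤
      q.lam * ∑ v, C.weight v * ((if v ∈ q.act then 1 else 1 / 2) * q.mean v) := by
  have htel : ∀ N, (1 / 2) * q.flow (fun _ v' => q.excess w 1 v' ^ 2) ≤
      (1 / 2) * q.flow (fun _ v' => q.excess w (N + 1) v' ^ 2) +
      q.lam * ∑ v, C.weight v * ∑ n ∈ Finset.range N, q.y n v * q.excess w (n + 1) v := by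
    intro N
    induction N with
    | zero => simp
    | succ N ih =>
      have h1 := h.flow_excess_sub_le N
      simp only [Finset.sum_range_succ, mul_add, Finset.sum_add_distrib] at ih ⊢
      linarith
  have hlim : Filter.Tendsto (fun N => (1 / 2) * q.flow (fun _ v' => q.excess w (N + 1) v' ^ 2) +
      q.lam * ∑ v, C.weight v * ((if v ∈ q.act then 1 else 1 / 2) * q.mean v)) Filter.atTop
      (nhds ((1 / 2) * q.flow (fun _ _ => (0 : ℝ) ^ 2) +
      q.lam * ∑ v, C.weight v * ((if v ∈ q.act then 1 else 1 / 2) * q.mean v))) := by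
    refine Filter.Tendsto.add_const _ (Filter.Tendsto.const_mul _ ?_)
    refine tendsto_finsetSum _ fun v _ => tendsto_finsetSum _ fun v' _ =>
      Filter.Tendsto.const_mul _ (Filter.Tendsto.pow ?_ 2)
    exact squeeze_zero (fun N => excess_nonneg _ _) (fun N => h.excess_le (N + 1) v')
      (q.hasSum_one_sub_cdf v').summable.tendsto_atTop_zero
  have hfin := ge_of_tendsto' hlim fun N => (htel N).trans (add_le_add_right
    (mul_le_mul_of_nonneg_left (Finset.sum_le_sum fun v _ => mul_le_mul_of_nonneg_left
      (h.sum_y_mul_excess_le N v) (C.weight_pos v).le) q.lam_pos.le) _)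
  simpa [flow] using hfin

/-- The total loss over the inactive states is at most the mean queue length. -/
theorem sum_le_mean (h : q.IsLoss S w) (hact : q.act.Nonempty) :
    ∑ v ∈ q.actᶜ, C.weight v * max (w v) 0 ≤ ∑ v, C.weight v * q.mean v := by
  have hA : ((q.actᶜ : Finset Ω) : Set Ω) ≠ Set.univ := by
    obtain ⟨a, ha⟩ := hact
    intro h0
    have : a ∈ ((q.actᶜ : Finset Ω) : Set Ω) := h0 ▸ Set.mem_univ a
    simp [ha] at this
  -- `α` is `lam` times the mean hitting time of the active states.
  obtain ⟨α, hα0, hα1⟩ := C.exists_poisson hA fun _ => q.lam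
  replace hα0 : ∀ v ∈ q.act, α v = 0 := fun v hv => hα0 v (by simpa using hv)
  replace hα1 : ∀ v ∉ q.act, -C.gen α v = q.lam := fun v hv => hα1 v (by simpa using hv)
  have hα : ∀ v, 0 ≤ α v := fun v => by
    have := C.le_of_subharmonic hA (f := fun v => -1 * α v) (M := 0) (fun v hv => by
      rw [C.gen_const_mul]
      have := hα1 v (by simpa using hv)
      linarith [q.lam_pos]) (fun v hv => by simp [hα0 v (by simpa using hv)]) v
    linarith
  have hαm : ∀ v ∉ q.act, α v ≤ q.mean v := by
    intro v hv
    -- Lowering the mean by `1 - y 0` on active states cancels the service term, so -gen χ = `lam`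
    -- at inactive states, as for `α`, while χ ≥ 0 on active ones.
    set χ : Ω → ℝ := fun v => q.mean v - (if v ∈ q.act then 1 - q.y 0 v else 0) with hχ
    have hle := C.le_of_subharmonic hA (f := fun v => α v - χ v) (M := 0) (fun v hv => by
      have hv' : v ∉ q.act := by simpa using hv
      rw [C.gen_sub, hχ, C.gen_sub]
      have e1 := hα1 v hv'
      have e2 := q.gen_mean v
      have e3 : C.gen (fun v => if v ∈ q.act then 1 - q.y 0 v else 0) v =
          ∑ v' ∈ q.act, C.rate v v' * (1 - q.y 0 v') := by
        rw [ReversibleChain.gen, ← Finset.sum_add_sum_compl q.act,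
          Finset.sum_eq_zero (s := q.actᶜ), add_zero]
        · exact Finset.sum_congr rfl fun v' h' => by simp [h', hv']
        · intro v' h'; simp [hv', Finset.mem_compl.1 h']
      simp only [served, hv', if_false] at e2
      linarith) (fun v hv => by
        have hv' : v ∈ q.act := by simpa using hv
        simp only [hχ, hα0 v hv', hv', if_true]
        linarith [q.one_sub_y_zero_le_mean v]) v
    simp only [hχ, hv, if_false] at hle
    linarith
  have hαsq : q.flow (fun v _ => α v ^ 2) ≤ q.lam * ∑ v ∈ q.actᶜ, C.weight v * α v := by
    have e1 : q.flow (fun v v' => (α v - α v') * (α v - α v')) ≤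
        ∑ v, C.weight v * (α v * -C.gen α v) := q.flow_le_energy fun v v' _ => mul_self_nonneg _
    have e2 : ∑ v, C.weight v * (α v * -C.gen α v) =
        q.lam * ∑ v ∈ q.actᶜ, C.weight v * α v := by
      rw [← Finset.sum_add_sum_compl q.act, Finset.sum_eq_zero (s := q.act), zero_add,
        Finset.mul_sum]
      · exact Finset.sum_congr rfl fun v hv => by rw [hα1 v (Finset.mem_compl.1 hv)]; ring
      · intro v hv; rw [hα0 v hv]; ring
    rw [← e2]
    refine le_trans (q.flow_mono fun v _ v' hv' => ?_) e1
    rw [hα0 v' hv']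
    exact le_of_eq (by ring)
  -- On active states the loss is lowered by `cdf 1 = y 0`, which exactly offsets the source of `w`
  -- at inactive neighbours and makes `m` subharmonic there.
  set m : Ω → ℝ := fun v => if v ∈ q.act then q.excess w 1 v else max (w v) 0 with hm
  have hm0 : ∀ v, 0 ≤ m v := fun v => by
    simp only [hm]
    split_ifs
    · exact excess_nonneg _ _
    · exact le_max_right _ _
  have hmgen : ∀ v ∉ q.act, 0 ≤ C.gen m v := by
    intro v hv
    have hpos : m v = 0 → 0 ≤ C.gen m v := fun h0 =>
      Finset.sum_nonneg fun v' _ => mul_nonneg (C.rate_nonneg v v') (by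
        rw [h0, sub_zero]; exact hm0 v')
    rcases le_or_gt (w v) 0 with hw | hw
    · exact hpos (by simp only [hm, hv, if_false]; exact max_eq_right hw)
    · have hvS : v ∈ S := by
        by_contra hvS
        linarith [h.boundary_inact v hvS hv]
      have e1 := h.gen_eq v hvS
      simp only [served, hv, if_false] at e1
      have hmv : m v = w v := by simp only [hm, hv, if_false]; exact max_eq_left hw.le
      have e2 : C.gen w v - ∑ v' ∈ q.act, C.rate v v' * q.y 0 v' ≤ C.gen m v := by
        rw [ReversibleChain.gen, ReversibleChain.gen, ← Finset.sum_add_sum_compl q.act,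
          ← Finset.sum_add_sum_compl q.act, add_sub_right_comm, ← Finset.sum_sub_distrib]
        refine add_le_add (Finset.sum_le_sum fun v' hv' => ?_) (Finset.sum_le_sum fun v' hv' => ?_)
        · rw [← mul_sub, hmv]
          refine mul_le_mul_of_nonneg_left ?_ (C.rate_nonneg v v')
          simp only [hm, hv', if_true, excess]
          have : w v' - q.y 0 v' ≤ max (w v' - q.cdf 1 v') 0 := by
            rw [show q.cdf 1 v' = q.y 0 v' by simp [cdf]]
            exact le_max_left _ _
          linarith
        · rw [hmv]
          refine mul_le_mul_of_nonneg_left ?_ (C.rate_nonneg v v')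
          simp only [hm, Finset.mem_compl.1 hv', if_false]
          linarith [le_max_left (w v') 0]
      linarith
  have hb : q.lam * ∑ v ∈ q.actᶜ, C.weight v * max (w v) 0 ≤
      q.flow fun v v' => α v * q.excess w 1 v' := by
    have e1 : ∑ v, C.weight v * (α v * -C.gen m v) ≤ 0 := Finset.sum_nonpos fun v _ => by
      by_cases hv : v ∈ q.act
      · rw [hα0 v hv]; simp
      · exact mul_nonpos_of_nonneg_of_nonpos (C.weight_pos v).le
          (mul_nonpos_of_nonneg_of_nonpos (hα v) (by linarith [hmgen v hv]))
    rw [C.gen_symm, ← Finset.sum_add_sum_compl q.act] at e1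
    have e2 : ∑ v ∈ q.actᶜ, C.weight v * (m v * -C.gen α v) =
        q.lam * ∑ v ∈ q.actᶜ, C.weight v * max (w v) 0 := by
      rw [Finset.mul_sum]
      refine Finset.sum_congr rfl fun v hv => ?_
      have hv' := Finset.mem_compl.1 hv
      rw [hα1 v hv']
      simp only [hm, hv', if_false]
      ring
    have e3 : ∑ v ∈ q.act, C.weight v * (m v * -C.gen α v) =
        -q.flow fun v v' => α v * q.excess w 1 v' := by
      rw [flow, Finset.sum_comm, ← Finset.sum_neg_distrib]
      refine Finset.sum_congr rfl fun v hv => ?_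
      have : C.gen α v = ∑ v' ∈ q.actᶜ, C.rate v v' * α v' := by
        rw [ReversibleChain.gen, ← Finset.sum_add_sum_compl q.act,
          Finset.sum_eq_zero (s := q.act), zero_add]
        · exact Finset.sum_congr rfl fun v' _ => by rw [hα0 v hv, sub_zero]
        · intro v' h'; rw [hα0 v hv, hα0 v' h']; ring
      rw [this, ← Finset.sum_neg_distrib, Finset.mul_sum, Finset.mul_sum,
        ← Finset.sum_neg_distrib]
      refine Finset.sum_congr rfl fun v' _ => ?_
      simp only [hm, hv, if_true]
      rw [C.reversible v' v]
      ring
    linarith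
  have hcs : q.flow (fun v v' => α v * q.excess w 1 v') ≤
      (1 / 2) * q.flow (fun v _ => α v ^ 2) +
      (1 / 2) * q.flow (fun _ v' => q.excess w 1 v' ^ 2) := by
    rw [← flow_const_mul, ← flow_const_mul, ← flow_add]
    exact q.flow_mono fun v _ v' _ => by nlinarith [sq_nonneg (α v - q.excess w 1 v')]
  -- Inactive states receive ½ from `α ≤ mean` and ½ from the excess flow; active states receive 1
  -- from the latter alone.
  have hfin : (1 / 2) * ∑ v ∈ q.actᶜ, C.weight v * α v +
      ∑ v, C.weight v * ((if v ∈ q.act then 1 else 1 / 2) * q.mean v) ≤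
      ∑ v, C.weight v * q.mean v := by
    rw [← Finset.sum_add_sum_compl q.act, ← Finset.sum_add_sum_compl q.act, Finset.mul_sum,
      add_left_comm, ← Finset.sum_add_distrib]
    refine add_le_add (Finset.sum_le_sum fun v hv => ?_) (Finset.sum_le_sum fun v hv => ?_)
    · simp [hv]
    · have hv' := Finset.mem_compl.1 hv
      have := mul_le_mul_of_nonneg_left (hαm v hv') (C.weight_pos v).le
      simp only [hv', if_false]
      linarith
  have htot := h.flow_excess_le
  have : q.lam * ∑ v ∈ q.actᶜ, C.weight v * max (w v) 0 ≤
      q.lam * ∑ v, C.weight v * q.mean v := by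
    have := mul_le_mul_of_nonneg_left hfin q.lam_pos.le
    linarith
  exact le_of_mul_le_mul_left this q.lam_pos

end IsLoss

/-! ### Conclusions for a single queue. -/

variable (q)

/-- While the chain stays in a proper subset `S` of its states the queue builds up at least as
fast as the accumulated drift, up to a factor two in the mean. -/
theorem sum_drift_le_two_mul_mean (hact : q.act.Nonempty) (hS : S ≠ Finset.univ) {D : Ω → ℝ}
    (hD0 : ∀ v ∉ S, D v = 0)
    (hD : ∀ v ∈ S, -C.gen D v = q.lam - (q.kap + q.rel) * q.active v) :
    ∑ v, C.weight v * D v ≤ 2 * ∑ v, C.weight v * q.mean v := by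
  -- The `active` term replaces the release rate in the drift by the release flow in `gen_mean`, so
  -- that only completions at an empty queue remain.
  have h : q.IsLoss S fun v => D v - q.mean v + q.active v := by
    refine ⟨hS, fun v hv => ?_, fun v hv hva => ?_, fun v hv hva => ?_⟩
    · rw [C.gen_add, C.gen_sub]
      have e1 := hD v hv
      have e2 := q.gen_mean v
      have e3 := q.gen_active v
      simp only [served, active] at e1 e2 e3 ⊢
      split_ifs at * with hva
      · linarith
      · simp only [mul_sub, mul_one, Finset.sum_sub_distrib] at e2
        linarith
    · simp only [hD0 v hv, active, hva, if_true]
      linarith [q.one_sub_y_zero_le_mean v]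
    · simp only [hD0 v hv, active, hva, if_false]
      linarith [q.mean_nonneg v]
  have h1 := h.sum_le_mean hact
  have h2 : ∑ v, C.weight v * D v ≤ ∑ v, C.weight v * q.mean v +
      ∑ v ∈ q.actᶜ, C.weight v * max (D v - q.mean v + q.active v) 0 := by
    rw [← Finset.sum_add_sum_compl q.act, ← Finset.sum_add_sum_compl q.act, add_assoc,
      ← Finset.sum_add_distrib]
    refine add_le_add (Finset.sum_le_sum fun v hv => ?_) (Finset.sum_le_sum fun v hv => ?_)
    · refine mul_le_mul_of_nonneg_left ?_ (C.weight_pos v).le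
      have := h.le_one v
      simp only [active, hv, if_true] at this
      linarith
    · rw [← mul_add]
      refine mul_le_mul_of_nonneg_left ?_ (C.weight_pos v).le
      have := le_max_left (D v - q.mean v + q.active v) 0
      simp only [active, Finset.mem_compl.1 hv, if_false] at this ⊢
      linarith
  linarith

/-- The arrival rate does not exceed the mean service rate. -/
theorem lam_mul_sum_weight_le :
    q.lam * ∑ v, C.weight v ≤ (q.kap + q.rel) * ∑ v, C.weight v * q.active v := by
  -- The generator of mean - active is the service rate minus `lam`, less a nonnegative loss from
  -- empty queues; its weighted sum is zero.
  have h1 := C.sum_weight_mul_gen fun v => q.mean v - q.active v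
  have h2 : ∀ v, C.gen (fun v => q.mean v - q.active v) v ≤
      (q.kap + q.rel) * q.active v - q.lam := fun v => by
    rw [C.gen_sub]
    have e2 := q.gen_mean v
    have e3 := q.gen_active v
    have e4 := served_nonneg (q := q) (q.y_nonneg 0) v
    simp only [served, active] at e2 e3 e4 ⊢
    split_ifs at * with hva
    · linarith
    · simp only [mul_sub, mul_one, Finset.sum_sub_distrib] at e2
      linarith
  have h3 := Finset.sum_le_sum fun v (_ : v ∈ Finset.univ) =>
    mul_le_mul_of_nonneg_left (h2 v) (C.weight_pos v).le
  rw [h1] at h3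
  simp only [mul_sub, Finset.sum_sub_distrib] at h3
  rw [Finset.mul_sum, Finset.mul_sum]
  have e1 : ∑ v, q.lam * C.weight v = ∑ v, C.weight v * q.lam :=
    Finset.sum_congr rfl fun _ _ => mul_comm _ _
  have e2 : ∑ v, (q.kap + q.rel) * (C.weight v * q.active v) =
      ∑ v, C.weight v * ((q.kap + q.rel) * q.active v) :=
    Finset.sum_congr rfl fun _ _ => by ring
  linarith

end ModulatedQueue

/-! ### Balance equations of the joint process. -/

namespace FixedRateNetwork

variable {V : Type*} (net : FixedRateNetwork V)

theorem up_pos (j : V) : 0 < net.nu j * net.phi j := mul_pos (net.nu_pos j) (net.phi_pos j)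

theorem down_pos (j : V) : 0 < net.mu j * net.psi j := mul_pos (net.mu_pos j) (net.psi_pos j)

theorem stay_nonneg (j : V) : 0 ≤ net.mu j * (1 - net.psi j) :=
  mul_nonneg (net.mu_pos j).le (by linarith [net.psi_le_one j])

variable {net} in
theorem summable_prob (p : PMF net.State) : Summable fun s => (p s).toReal :=
  ENNReal.summable_toReal p.tsum_coe_ne_top

variable {net} in
theorem summable_prob_mul (p : PMF net.State) {g : net.State → ℝ} {K : ℝ} (hg : ∀ s, |g s| ≤ K) :
    Summable fun s => (p s).toReal * g s := by
  refine Summable.of_norm_bounded ((summable_prob p).mul_right K) fun s => ?_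
  rw [Real.norm_eq_abs, abs_mul, abs_of_nonneg ENNReal.toReal_nonneg]
  exact mul_le_mul_of_nonneg_left (hg s) ENNReal.toReal_nonneg

variable {net} in
theorem tsum_prob_mul_eq_toReal (p : PMF net.State) {g : net.State → ℝ} (hg : ∀ s, 0 ≤ g s) :
    ∑' s, (p s).toReal * g s = (∑' s, p s * ENNReal.ofReal (g s)).toReal := by
  rw [ENNReal.tsum_toReal_eq fun s => ENNReal.mul_ne_top (p.apply_ne_top s) ENNReal.ofReal_ne_top]
  simp only [ENNReal.toReal_mul, ENNReal.toReal_ofReal (hg _)]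

variable {net} in
theorem activityProb_eq (p : PMF net.State) (u : net.Activity) :
    net.activityProb p u = ∑' x : V → ℕ, (p (u, x)).toReal :=
  ENNReal.tsum_toReal_eq fun x => p.apply_ne_top (u, x)

variable {net} in
theorem activityProb_nonneg (p : PMF net.State) (u : net.Activity) : 0 ≤ net.activityProb p u :=
  ENNReal.toReal_nonneg

variable [Fintype V] [DecidableEq V]

/-- The rate of the activation of node `j` from `u` to `u'`. -/
noncomputable def upRate (j : V) (u u' : net.Activity) : ℝ :=
  if j ∉ u.1 ∧ u'.1 = insert j u.1 then net.nu j * net.phi j else 0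

/-- The rate of the release by node `j` from `u` to `u'`. -/
noncomputable def downRate (j : V) (u u' : net.Activity) : ℝ :=
  if j ∈ u.1 ∧ u'.1 = u.1.erase j then net.mu j * net.psi j else 0

/-- The rate of transmission completions of node `j` without release. -/
noncomputable def stayRate (j : V) (u : net.Activity) : ℝ :=
  if j ∈ u.1 then net.mu j * (1 - net.psi j) else 0

theorem upRate_nonneg (j : V) (u u' : net.Activity) : 0 ≤ net.upRate j u u' := by
  unfold upRate; split_ifs; exacts [(net.up_pos j).le, le_rfl]

theorem downRate_nonneg (j : V) (u u' : net.Activity) : 0 ≤ net.downRate j u u' := by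
  unfold downRate; split_ifs; exacts [(net.down_pos j).le, le_rfl]

theorem activityRate_eq (u u' : net.Activity) :
    net.activityRate u u' = ∑ j, (net.upRate j u u' + net.downRate j u u') := rfl

theorem activityRate_nonneg (u u' : net.Activity) : 0 ≤ net.activityRate u u' :=
  Finset.sum_nonneg fun j _ => add_nonneg (net.upRate_nonneg j u u') (net.downRate_nonneg j u u')

/-- The queue lengths after an arrival at node `j`. -/
abbrev arrive (j : V) (x : V → ℕ) : V → ℕ := Function.update x j (x j + 1)

/-- The queue lengths after a transmission completion at node `j`. -/
abbrev depart (j : V) (x : V → ℕ) : V → ℕ := Function.update x j (x j - 1)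

/-- The sum of `f` over the states, weighted by the transition rates out of `s`. -/
noncomputable def rateSum (f : net.State → ℝ) (s : net.State) : ℝ :=
  ∑ j, (net.lam j * f (s.1, arrive j s.2) + ∑ u', net.upRate j s.1 u' * f (u', s.2) +
    net.stayRate j s.1 * f (s.1, depart j s.2) +
    ∑ u', net.downRate j s.1 u' * f (u', depart j s.2))

theorem jointRate_nonneg (s s' : net.State) : 0 ≤ net.jointRate s s' := by
  refine Finset.sum_nonneg fun j _ => ?_
  have h1 := (net.lam_pos j).le
  have h2 := (net.up_pos j).le
  have h3 := net.stay_nonneg j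
  have h4 := (net.down_pos j).le
  refine add_nonneg (add_nonneg (add_nonneg ?_ ?_) ?_) ?_ <;> split_ifs <;> first | assumption | rfl

theorem hasSum_of_queue_eq (g : net.State → ℝ) (x : V → ℕ) (hg : ∀ s, s.2 ≠ x → g s = 0) :
    HasSum g (∑ u, g (u, x)) := by
  have h := hasSum_sum_of_ne_finset_zero (L := .unconditional _) (f := g)
    (s := (Finset.univ : Finset net.Activity) ×ˢ {x}) (fun s hs => hg s fun h =>
      hs (Finset.mem_product.2 ⟨Finset.mem_univ _, Finset.mem_singleton.2 h⟩))
  rw [Finset.sum_product] at h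
  simpa only [Finset.sum_singleton] using h

theorem hasSum_jointRate (f : net.State → ℝ) (s : net.State) :
    HasSum (fun s' => net.jointRate s s' * f s') (net.rateSum f s) := by
  simp only [jointRate, Finset.sum_mul, add_mul]
  refine hasSum_sum fun j _ => ?_
  refine ((HasSum.add ?_ ?_).add ?_).add ?_
  · have h := net.hasSum_of_queue_eq (fun s' => (if s'.1 = s.1 ∧ s'.2 = arrive j s.2
      then net.lam j else 0) * f s') (arrive j s.2) fun s' hs' => by simp [hs']
    simpa using h
  · have h := net.hasSum_of_queue_eq (fun s' => (if j ∉ s.1.1 ∧ s'.1.1 = insert j s.1.1 ∧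
      s'.2 = s.2 then net.nu j * net.phi j else 0) * f s') s.2 fun s' hs' => by simp [hs']
    simpa only [upRate, and_true] using h
  · have h := net.hasSum_of_queue_eq (fun s' => (if j ∈ s.1.1 ∧ s'.1 = s.1 ∧
      s'.2 = depart j s.2 then net.mu j * (1 - net.psi j) else 0) * f s') (depart j s.2)
      fun s' hs' => by simp [hs']
    convert h using 1
    rw [Finset.sum_eq_single s.1 (fun u _ hu => by simp [hu]) (by simp)]
    simp [stayRate]
  · have h := net.hasSum_of_queue_eq (fun s' => (if j ∈ s.1.1 ∧ s'.1.1 = s.1.1.erase j ∧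
      s'.2 = depart j s.2 then net.mu j * net.psi j else 0) * f s') (depart j s.2)
      fun s' hs' => by simp [hs']
    simpa only [downRate, and_true] using h

theorem rateSum_nonneg {f : net.State → ℝ} (hf : ∀ s, 0 ≤ f s) (s : net.State) :
    0 ≤ net.rateSum f s :=
  (net.hasSum_jointRate f s).nonneg fun s' => mul_nonneg (net.jointRate_nonneg s s') (hf s')

theorem rateSum_mono {f g : net.State → ℝ} (hfg : ∀ s, f s ≤ g s) (s : net.State) :
    net.rateSum f s ≤ net.rateSum g s :=
  hasSum_le (fun s' => mul_le_mul_of_nonneg_left (hfg s') (net.jointRate_nonneg s s'))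
    (net.hasSum_jointRate f s) (net.hasSum_jointRate g s)

/-- The total exit rate depends on the activity state only, so queue length 0 represents all queue
lengths. -/
theorem exists_rateSum_one_le : ∃ K, ∀ s, net.rateSum (fun _ => 1) s ≤ K := by
  refine ⟨∑ u, net.rateSum (fun _ => 1) (u, 0), fun s => ?_⟩
  exact Finset.single_le_sum (f := fun u => net.rateSum (fun _ => 1) (u, 0))
    (fun u _ => net.rateSum_nonneg (fun _ => zero_le_one) _) (Finset.mem_univ s.1)

variable {net} {p : PMF net.State}

/-- In the stationary distribution the generator of the joint process has mean zero on bounded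
functions. -/
theorem IsStationary.tsum_gen_eq_zero (hp : net.IsStationary p) {f : net.State → ℝ}
    (hf0 : ∀ s, 0 ≤ f s) (hf1 : ∀ s, f s ≤ 1) :
    ∑' s, (p s).toReal * (net.rateSum f s - f s * net.rateSum (fun _ => 1) s) = 0 := by
  obtain ⟨K, hK⟩ := net.exists_rateSum_one_le
  have h1 := net.rateSum_nonneg (f := fun _ => 1) fun _ => zero_le_one
  have hof : ∀ (g : net.State → ℝ), (∀ s, 0 ≤ g s) → ∀ s,
      ∑' s', ENNReal.ofReal (net.jointRate s s') * ENNReal.ofReal (g s') =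
        ENNReal.ofReal (net.rateSum g s) := fun g hg s => by
    rw [← (net.hasSum_jointRate g s).tsum_eq, ENNReal.ofReal_tsum_of_nonneg
      (fun s' => mul_nonneg (net.jointRate_nonneg s s') (hg s')) (net.hasSum_jointRate g s).summable]
    simp only [ENNReal.ofReal_mul (net.jointRate_nonneg s _)]
  -- In `ℝ≥0∞` the sums may be exchanged freely; the difference is taken only after bounded rates
  -- make both sides finite.
  have key : ∑' s, p s * ENNReal.ofReal (net.rateSum f s) =
      ∑' s, p s * ENNReal.ofReal (f s * net.rateSum (fun _ => 1) s) := by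
    calc ∑' s, p s * ENNReal.ofReal (net.rateSum f s)
        = ∑' s, ∑' s', p s * ENNReal.ofReal (net.jointRate s s') * ENNReal.ofReal (f s') := by
          refine tsum_congr fun s => ?_
          rw [← hof f hf0 s, ← ENNReal.tsum_mul_left]
          simp only [mul_assoc]
      _ = ∑' s', (∑' s, p s * ENNReal.ofReal (net.jointRate s s')) * ENNReal.ofReal (f s') := by
          rw [ENNReal.tsum_comm]
          simp only [ENNReal.tsum_mul_right]
      _ = ∑' s, p s * ENNReal.ofReal (f s * net.rateSum (fun _ => 1) s) := by
          refine tsum_congr fun s => ?_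
          rw [hp s, ENNReal.ofReal_mul (hf0 s), ← hof (fun _ => 1) (fun _ => zero_le_one) s]
          simp only [ENNReal.ofReal_one, mul_one]
          ring
  have hb1 : ∀ s, |net.rateSum f s| ≤ K := fun s => by
    rw [abs_of_nonneg (net.rateSum_nonneg hf0 s)]
    exact (net.rateSum_mono hf1 s).trans (hK s)
  have hb2 : ∀ s, |f s * net.rateSum (fun _ => 1) s| ≤ K := fun s => by
    rw [abs_of_nonneg (mul_nonneg (hf0 s) (h1 s))]
    exact (mul_le_of_le_one_left (h1 s) (hf1 s)).trans (hK s)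
  simp only [mul_sub]
  rw [(summable_prob_mul p hb1).tsum_sub (summable_prob_mul p hb2),
    tsum_prob_mul_eq_toReal p (net.rateSum_nonneg hf0),
    tsum_prob_mul_eq_toReal p fun s => mul_nonneg (hf0 s) (h1 s), key, sub_self]

/-- The probability that the activity state is `u` and node `i` holds `k` packets. -/
noncomputable def queueProb (p : PMF net.State) (i : V) (k : ℕ) (u : net.Activity) : ℝ :=
  ∑' x : V → ℕ, (p (u, x)).toReal * if x i = k then 1 else 0

theorem tsum_prob_mul_eq_sum (p : PMF net.State) {g : net.State → ℝ} {K : ℝ}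
    (hg : ∀ s, |g s| ≤ K) :
    ∑' s, (p s).toReal * g s = ∑ u, ∑' x : V → ℕ, (p (u, x)).toReal * g (u, x) := by
  rw [(summable_prob_mul p hg).tsum_prod, tsum_fintype]

theorem summable_prob_slice (p : PMF net.State) (u : net.Activity) {g : (V → ℕ) → ℝ} {K : ℝ}
    (hg : ∀ x, |g x| ≤ K) : Summable fun x => (p (u, x)).toReal * g x :=
  (summable_prob_mul p (g := fun s => g s.2) fun s => hg s.2).prod_factor u

theorem sum_queueProb (p : PMF net.State) (i : V) (n : ℕ) (u : net.Activity) :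
    ∑ k ∈ Finset.range (n + 1), queueProb p i k u =
      ∑' x : V → ℕ, (p (u, x)).toReal * if x i ≤ n then 1 else 0 := by
  simp only [queueProb]
  rw [← Summable.tsum_finsetSum fun k _ => summable_prob_slice p u (K := 1) fun x => by
    split_ifs <;> simp]
  refine tsum_congr fun x => ?_
  rw [← Finset.mul_sum, Finset.sum_ite_eq]
  simp

theorem sum_activityProb (p : PMF net.State) : ∑ u, net.activityProb p u = 1 := by
  have h := tsum_prob_mul_eq_sum p (g := fun _ => 1) (K := 1) fun _ => by simp
  simp only [mul_one] at h
  simp only [activityProb_eq, ← h]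
  rw [← ENNReal.tsum_toReal_eq p.apply_ne_top, p.tsum_coe, ENNReal.toReal_one]

theorem rateSum_sub (f : net.State → ℝ) (s : net.State) :
    net.rateSum f s - f s * net.rateSum (fun _ => 1) s =
      ∑ j, (net.lam j * (f (s.1, arrive j s.2) - f s) +
        ∑ u', net.upRate j s.1 u' * (f (u', s.2) - f s) +
        net.stayRate j s.1 * (f (s.1, depart j s.2) - f s) +
        ∑ u', net.downRate j s.1 u' * (f (u', depart j s.2) - f s)) := by
  simp only [rateSum, Finset.mul_sum, ← Finset.sum_sub_distrib]
  refine Finset.sum_congr rfl fun j _ => ?_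
  simp only [mul_sub, Finset.sum_sub_distrib, mul_one, mul_add, Finset.mul_sum]
  simp only [mul_comm (f s)]
  ring

/-- The global balance equations of the activity process. -/
theorem IsStationary.activity_balance (hp : net.IsStationary p) (v : net.Activity) :
    ∑ u, net.activityProb p u * net.activityRate u v =
      net.activityProb p v * ∑ u, net.activityRate v u := by
  have h := hp.tsum_gen_eq_zero (f := fun s => if s.1 = v then 1 else 0)
    (fun s => by split_ifs <;> norm_num) (fun s => by split_ifs <;> norm_num)
  have hpt : ∀ s : net.State, net.rateSum (fun s => if s.1 = v then 1 else 0) s -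
      (if s.1 = v then 1 else 0) * net.rateSum (fun _ => 1) s =
      net.activityRate s.1 v - if s.1 = v then ∑ u, net.activityRate v u else 0 := fun s => by
    rw [rateSum_sub]
    simp only [sub_self, mul_zero, zero_add, add_zero, mul_sub, Finset.sum_sub_distrib,
      mul_ite, mul_one, Finset.sum_ite_eq', Finset.mem_univ, if_true, activityRate_eq]
    rw [Finset.sum_comm]
    simp only [Finset.sum_add_distrib]
    split_ifs with hs
    · subst hs
      simp only [Finset.sum_sub_distrib]
      ring
    · simp
  simp only [hpt] at h
  set a : net.Activity → ℝ := fun w =>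
    net.activityRate w v - if w = v then ∑ u, net.activityRate v u else 0 with ha
  change ∑' s : net.State, (p s).toReal * a s.1 = 0 at h
  rw [tsum_prob_mul_eq_sum p (g := fun s => a s.1) (K := ∑ w, |a w|) fun s =>
    Finset.single_le_sum (f := fun w => |a w|) (fun w _ => abs_nonneg _)
      (Finset.mem_univ s.1)] at h
  simp only [tsum_mul_right, ← activityProb_eq] at h
  simp only [ha, mul_sub, Finset.sum_sub_distrib, mul_ite, mul_zero,
    Finset.sum_ite_eq', Finset.mem_univ, if_true] at h
  linarith

/-- Test stationarity on the indicator of {U = v, X_i ≤ n}. Arrivals leave the level set only from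
`n`, departures enter only from `n + 1`, and the truncation at 0 never crosses the cut. -/
theorem IsStationary.queue_cut (hp : net.IsStationary p) (i : V) (n : ℕ) (v : net.Activity) :
    net.lam i * queueProb p i n v =
      ∑ u, net.activityRate u v * ∑ k ∈ Finset.range (n + 1), queueProb p i k u
      - (∑ u, net.activityRate v u) * ∑ k ∈ Finset.range (n + 1), queueProb p i k v
      + net.stayRate i v * queueProb p i (n + 1) v
      + ∑ u, net.downRate i u v * queueProb p i (n + 1) u := by
  set f : net.State → ℝ := fun s => if s.1 = v ∧ s.2 i ≤ n then 1 else 0 with hf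
  have h := hp.tsum_gen_eq_zero (f := f)
    (fun s => by simp only [hf]; split_ifs <;> norm_num)
    (fun s => by simp only [hf]; split_ifs <;> norm_num)
  let a : net.Activity → ℝ := fun u =>
    net.activityRate u v - if u = v then ∑ u', net.activityRate v u' else 0
  let b : net.Activity → ℝ := fun u => net.downRate i u v + if u = v then net.stayRate i v else 0
  let c : net.Activity → ℝ := fun u => if u = v then net.lam i else 0
  have hpt : ∀ s : net.State, net.rateSum f s - f s * net.rateSum (fun _ => 1) s =
      a s.1 * (if s.2 i ≤ n then 1 else 0) + b s.1 * (if s.2 i = n + 1 then 1 else 0)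
        - c s.1 * (if s.2 i = n then 1 else 0) := fun s => by
    have harr : ∀ j, f (s.1, arrive j s.2) - f s =
        if j = i then -(if s.1 = v ∧ s.2 i = n then 1 else 0) else 0 := fun j => by
      by_cases hj : j = i
      · subst hj
        simp only [hf, arrive, Function.update_self, if_true]
        by_cases hv : s.1 = v
        · simp only [hv, true_and]
          split_ifs <;> first | omega | norm_num
        · simp [hv]
      · simp [hf, arrive, hj, Function.update_of_ne (Ne.symm hj)]
    have hdep : ∀ j u', f (u', depart j s.2) = f (u', s.2) +
        if j = i then (if u' = v ∧ s.2 i = n + 1 then 1 else 0) else 0 := fun j u' => by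
      by_cases hj : j = i
      · subst hj
        simp only [hf, depart, Function.update_self, if_true]
        by_cases hv : u' = v
        · simp only [hv, true_and]
          split_ifs <;> first | omega | norm_num
        · simp [hv]
      · simp [hf, depart, hj, Function.update_of_ne (Ne.symm hj)]
    have hsum : ∀ r : net.Activity → ℝ, ∑ u', r u' * (f (u', s.2) - f s) =
        r v * (if s.2 i ≤ n then 1 else 0) - f s * ∑ u', r u' := fun r => by
      simp only [mul_sub, Finset.sum_sub_distrib, Finset.mul_sum]
      congr 1
      · rw [Finset.sum_eq_single v (fun u _ hu => by simp [hf, hu]) (by simp)]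
        simp [hf]
      · exact Finset.sum_congr rfl fun _ _ => mul_comm _ _
    have hsum2 : ∀ r : net.Activity → ℝ, ∑ u', r u' *
        (if u' = v ∧ s.2 i = n + 1 then 1 else 0) = r v * if s.2 i = n + 1 then 1 else 0 :=
      fun r => by
        rw [Finset.sum_eq_single v (fun u _ hu => by simp [hu]) (by simp)]
        simp
    have hterm : ∀ j, net.lam j * (f (s.1, arrive j s.2) - f s) +
        ∑ u', net.upRate j s.1 u' * (f (u', s.2) - f s) +
        net.stayRate j s.1 * (f (s.1, depart j s.2) - f s) +
        ∑ u', net.downRate j s.1 u' * (f (u', depart j s.2) - f s) =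
        ((net.upRate j s.1 v + net.downRate j s.1 v) * (if s.2 i ≤ n then 1 else 0)
          - f s * ∑ u', (net.upRate j s.1 u' + net.downRate j s.1 u')) +
        if j = i then -(net.lam i * if s.1 = v ∧ s.2 i = n then 1 else 0) +
          net.stayRate i s.1 * (if s.1 = v ∧ s.2 i = n + 1 then 1 else 0) +
          net.downRate i s.1 v * (if s.2 i = n + 1 then 1 else 0) else 0 := fun j => by
      have e1 : ∀ u', net.downRate j s.1 u' * (f (u', depart j s.2) - f s) =
          net.downRate j s.1 u' * (f (u', s.2) - f s) + if j = i then
            net.downRate j s.1 u' * (if u' = v ∧ s.2 i = n + 1 then 1 else 0) else 0 :=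
        fun u' => by rw [hdep]; split_ifs <;> ring
      simp only [e1, Finset.sum_add_distrib]
      rw [harr, hdep, hsum, hsum]
      by_cases hj : j = i
      · subst hj
        simp only [if_true]
        rw [hsum2]
        ring
      · simp only [hj, if_false, Finset.sum_const_zero]
        ring
    rw [rateSum_sub, Finset.sum_congr rfl fun j _ => hterm j, Finset.sum_add_distrib,
      Finset.sum_sub_distrib, Finset.sum_ite_eq', ← Finset.sum_mul, ← Finset.mul_sum,
      Finset.sum_comm, if_pos (Finset.mem_univ i)]
    simp only [← activityRate_eq, a, b, c, hf]
    by_cases hv : s.1 = v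
    · simp only [hv, true_and, if_true]
      ring
    · simp only [hv, false_and, if_false]
      ring
  simp only [hpt] at h
  have hab : ∀ (r : net.Activity → ℝ) (P : ℕ → Prop) [DecidablePred P] (s : net.State),
      |r s.1 * (if P (s.2 i) then 1 else 0)| ≤ ∑ u, |r u| := fun r P _ s => by
    rw [abs_mul]
    refine le_trans (mul_le_of_le_one_right (abs_nonneg _) (by split_ifs <;> simp)) ?_
    exact Finset.single_le_sum (f := fun u => |r u|) (fun _ _ => abs_nonneg _) (Finset.mem_univ s.1)
  have hE : ∀ (r : net.Activity → ℝ) (P : ℕ → Prop) [DecidablePred P],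
      ∑' s, (p s).toReal * (r s.1 * (if P (s.2 i) then 1 else 0)) =
      ∑ u, r u * ∑' x : V → ℕ, (p (u, x)).toReal * (if P (x i) then 1 else 0) := fun r P _ => by
    rw [tsum_prob_mul_eq_sum p (g := fun s => r s.1 * (if P (s.2 i) then 1 else 0)) (hab r P)]
    refine Finset.sum_congr rfl fun u _ => ?_
    rw [← tsum_mul_left]
    exact tsum_congr fun x => by ring
  have hsa := summable_prob_mul p (g := fun s => a s.1 * (if s.2 i ≤ n then 1 else 0))
    (hab a (· ≤ n))
  have hsb := summable_prob_mul p (g := fun s => b s.1 * (if s.2 i = n + 1 then 1 else 0))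
    (hab b (· = n + 1))
  have hsc := summable_prob_mul p (g := fun s => c s.1 * (if s.2 i = n then 1 else 0))
    (hab c (· = n))
  simp only [mul_sub (ENNReal.toReal _), mul_add (ENNReal.toReal _)] at h
  rw [(hsa.add hsb).tsum_sub hsc, hsa.tsum_add hsb, hE a (· ≤ n), hE b (· = n + 1),
    hE c (· = n)] at h
  simp only [← sum_queueProb] at h
  change ∑ u, a u * ∑ k ∈ Finset.range (n + 1), queueProb p i k u +
    ∑ u, b u * queueProb p i (n + 1) u - ∑ u, c u * queueProb p i n u = 0 at h
  simp only [a, b, c, sub_mul, add_mul, ite_mul, zero_mul, Finset.sum_sub_distrib,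
    Finset.sum_add_distrib, Finset.sum_ite_eq', Finset.mem_univ, if_true] at h
  linarith

end FixedRateNetwork

/-! ### Product form of the activity process, and each node as a modulated queue. -/

namespace FixedRateNetwork

variable {V : Type*} [Fintype V] [DecidableEq V] (net : FixedRateNetwork V)

/-- The product-form reversing measure of the activity process. -/
noncomputable def productWeight (u : net.Activity) : ℝ :=
  ∏ j ∈ u.1, net.nu j * net.phi j / (net.mu j * net.psi j)

theorem productWeight_pos (u : net.Activity) : 0 < net.productWeight u :=
  Finset.prod_pos fun j _ => div_pos (net.up_pos j) (net.down_pos j)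

theorem productWeight_mul_upRate (j : V) (u u' : net.Activity) :
    net.productWeight u * net.upRate j u u' = net.productWeight u' * net.downRate j u' u := by
  unfold upRate downRate
  by_cases h : j ∉ u.1 ∧ u'.1 = insert j u.1
  · have h' : j ∈ u'.1 ∧ u.1 = u'.1.erase j := by
      rw [h.2]
      exact ⟨Finset.mem_insert_self _ _, (Finset.erase_insert h.1).symm⟩
    rw [if_pos h, if_pos h', productWeight, productWeight, h.2, Finset.prod_insert h.1]
    rw [mul_right_comm, div_mul_cancel₀ _ (net.down_pos j).ne', mul_comm]
  · have h' : ¬(j ∈ u'.1 ∧ u.1 = u'.1.erase j) := fun h' => h (by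
      rw [h'.2]
      exact ⟨Finset.notMem_erase _ _, (Finset.insert_erase h'.1).symm⟩)
    rw [if_neg h, if_neg h', mul_zero, mul_zero]

theorem upRate_le (j : V) (u u' : net.Activity) : net.upRate j u u' ≤ net.activityRate u u' :=
  (le_add_of_nonneg_right (net.downRate_nonneg j u u')).trans
    (Finset.single_le_sum (f := fun j => net.upRate j u u' + net.downRate j u u')
      (fun j _ => add_nonneg (net.upRate_nonneg j u u') (net.downRate_nonneg j u u'))
      (Finset.mem_univ j))

theorem downRate_le (j : V) (u u' : net.Activity) : net.downRate j u u' ≤ net.activityRate u u' :=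
  (le_add_of_nonneg_left (net.upRate_nonneg j u u')).trans
    (Finset.single_le_sum (f := fun j => net.upRate j u u' + net.downRate j u u')
      (fun j _ => add_nonneg (net.upRate_nonneg j u u') (net.downRate_nonneg j u u'))
      (Finset.mem_univ j))

variable {net} in
theorem isIndepSet_of_subset (u : net.Activity) {t : Finset V} (ht : t ⊆ u.1) :
    net.G.IsIndepSet (t : Set V) :=
  u.2.mono (Finset.coe_subset.2 ht)

/-- Every state reaches the empty one by releases and is reached from it by activations, since
subsets of independent sets are independent. -/
theorem activity_irreducible (A : Set net.Activity) (hne : A.Nonempty)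
    (hA : ∀ v ∈ A, ∀ v', 0 < net.activityRate v v' → v' ∈ A) : A = Set.univ := by
  have hdown : ∀ t : Finset V, ∀ ht : net.G.IsIndepSet (t : Set V), (⟨t, ht⟩ : net.Activity) ∈ A →
      (⟨∅, by simp⟩ : net.Activity) ∈ A := by
    intro t
    induction t using Finset.induction_on with
    | empty => exact fun _ h => h
    | insert j t hj ih =>
      intro ht h
      have ht' := isIndepSet_of_subset ⟨_, ht⟩ (Finset.subset_insert j t)
      refine ih ht' (hA _ h _ (lt_of_lt_of_le ?_ (net.downRate_le j _ _)))
      rw [downRate, if_pos ⟨Finset.mem_insert_self _ _, (Finset.erase_insert hj).symm⟩]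
      exact net.down_pos j
  obtain ⟨a, ha⟩ := hne
  have h0 := hdown a.1 a.2 ha
  have hup : ∀ t : Finset V, ∀ ht : net.G.IsIndepSet (t : Set V),
      (⟨t, ht⟩ : net.Activity) ∈ A := by
    intro t
    induction t using Finset.induction_on with
    | empty => exact fun _ => h0
    | insert j t hj ih =>
      intro ht
      have ht' := isIndepSet_of_subset ⟨_, ht⟩ (Finset.subset_insert j t)
      refine hA _ (ih ht') _ (lt_of_lt_of_le ?_ (net.upRate_le j _ _))
      rw [upRate, if_pos ⟨hj, rfl⟩]
      exact net.up_pos j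
  exact Set.eq_univ_of_forall fun u => hup u.1 u.2

/-- The activity process with its product-form reversing measure. -/
noncomputable def productChain : ReversibleChain net.Activity where
  weight := net.productWeight
  rate := net.activityRate
  weight_pos := net.productWeight_pos
  rate_nonneg := net.activityRate_nonneg
  reversible v v' := by
    simp only [activityRate_eq, Finset.mul_sum, mul_add, net.productWeight_mul_upRate]
    simp only [← net.productWeight_mul_upRate]
    exact Finset.sum_congr rfl fun _ _ => add_comm _ _
  irreducible := net.activity_irreducible

variable {net} {p : PMF net.State}

/-- By reversibility of the product weight, global balance says that the ratio of π to it is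
harmonic. The maximum principle on the complement of each single state makes the ratio constant. -/
theorem IsStationary.activityProb_eq_mul (hp : net.IsStationary p) :
    ∃ c : ℝ, 0 < c ∧ ∀ u, net.activityProb p u = c * net.productWeight u := by
  have hw : ∀ u, net.productWeight u ≠ 0 := fun u => (net.productWeight_pos u).ne'
  set f : net.Activity → ℝ := fun u => net.activityProb p u / net.productWeight u with hf
  have hgen : ∀ v, net.productChain.gen f v = 0 := fun v => by
    have h : net.productWeight v * net.productChain.gen f v = 0 := by
      have hv : ∀ v', net.productWeight v * (net.activityRate v v' * (f v' - f v)) =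
          net.activityProb p v' * net.activityRate v' v
            - net.activityProb p v * net.activityRate v v' := fun v' => by
        have h1 : net.productWeight v * net.activityRate v v' =
          net.productWeight v' * net.activityRate v' v := net.productChain.reversible v v'
        have h2 : net.activityProb p v = f v * net.productWeight v := by
          rw [hf]; field_simp [hw v]
        have h3 : net.activityProb p v' = f v' * net.productWeight v' := by
          rw [hf]; field_simp [hw v']
        rw [h2, h3]
        linear_combination f v' * h1
      rw [ReversibleChain.gen, Finset.mul_sum]
      change ∑ v', net.productWeight v * (net.activityRate v v' * (f v' - f v)) = 0
      simp only [hv]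
      rw [Finset.sum_sub_distrib, hp.activity_balance, ← Finset.mul_sum, sub_self]
    exact (mul_eq_zero.1 h).resolve_left (hw v)
  have hle : ∀ u v, f v ≤ f u := fun u =>
    net.productChain.le_of_subharmonic (A := {u}ᶜ) (by simp) (fun v _ => (hgen v).ge)
      fun v hv => by
        rw [Set.notMem_compl_iff, Set.mem_singleton_iff] at hv
        rw [hv]
  let u0 : net.Activity := ⟨∅, by simp⟩
  have heq : ∀ u, net.activityProb p u = f u0 * net.productWeight u := fun u => by
    rw [← le_antisymm (hle u0 u) (hle u u0), hf]
    field_simp [hw u]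
  refine ⟨f u0, ?_, heq⟩
  refine lt_of_le_of_ne (div_nonneg (activityProb_nonneg p u0) (net.productWeight_pos u0).le)
    fun h => ?_
  have h1 := sum_activityProb p
  simp only [heq, ← h, zero_mul, Finset.sum_const_zero] at h1
  exact zero_ne_one h1

/-- The activity process with its stationary distribution. -/
noncomputable def IsStationary.chain (hp : net.IsStationary p) : ReversibleChain net.Activity where
  weight := net.activityProb p
  rate := net.activityRate
  weight_pos u := by
    obtain ⟨c, hc, h⟩ := hp.activityProb_eq_mul
    rw [h]
    exact mul_pos hc (net.productWeight_pos u)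
  rate_nonneg := net.activityRate_nonneg
  reversible v v' := by
    obtain ⟨c, hc, h⟩ := hp.activityProb_eq_mul
    have h1 : net.productWeight v * net.activityRate v v' =
      net.productWeight v' * net.activityRate v' v := net.productChain.reversible v v'
    rw [h, h]
    linear_combination c * h1
  irreducible := net.activity_irreducible

theorem IsStationary.activityProb_pos (hp : net.IsStationary p) (u : net.Activity) :
    0 < net.activityProb p u := hp.chain.weight_pos u

theorem activityRate_eq_downRate {i : V} {u u' : net.Activity} (hu : i ∈ u.1) (hu' : i ∉ u'.1) :
    net.activityRate u u' = net.downRate i u u' := by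
  rw [activityRate_eq, Finset.sum_eq_single i]
  · rw [upRate, if_neg (fun h => h.1 hu), zero_add]
  · intro j _ hj
    rw [upRate, downRate, if_neg, if_neg, add_zero]
    · exact fun h => hu' (by rw [h.2]; exact Finset.mem_erase.2 ⟨hj.symm, hu⟩)
    · exact fun h => hu' (by rw [h.2]; exact Finset.mem_insert_of_mem hu)
  · simp

/-- The mean number of packets at node `i` on the event that the activity state is `u`. -/
noncomputable def partialMean (p : PMF net.State) (i : V) (u : net.Activity) : ℝ≥0∞ :=
  ∑' x : V → ℕ, p (u, x) * (x i : ℝ≥0∞)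

theorem sum_partialMean (p : PMF net.State) (i : V) :
    ∑ u, partialMean p i u = net.meanQueue p i := by
  rw [meanQueue, ENNReal.tsum_prod', tsum_fintype]
  rfl

theorem tsum_ite_lt (k : ℕ) : ∑' n : ℕ, (if n < k then 1 else 0 : ℝ≥0∞) = k := by
  rw [tsum_eq_sum (s := Finset.range k) fun n hn => if_neg (by simpa using hn)]
  rw [Finset.sum_congr rfl fun n hn => if_pos (Finset.mem_range.1 hn)]
  simp

theorem hasSum_activityProb_sub (p : PMF net.State) (i : V) (u : net.Activity)
    (h : partialMean p i u ≠ ⊤) :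
    HasSum (fun n => net.activityProb p u - ∑ k ∈ Finset.range (n + 1), queueProb p i k u)
      (partialMean p i u).toReal := by
  have h1 : ∑' n : ℕ, ∑' x : V → ℕ, p (u, x) * (if n < x i then 1 else 0) =
      partialMean p i u := by
    rw [ENNReal.tsum_comm]
    simp only [ENNReal.tsum_mul_left, tsum_ite_lt]
    rfl
  have h2 := ENNReal.hasSum_toReal (h1 ▸ h)
  have h3 : ∀ n : ℕ, (∑' x : V → ℕ, p (u, x) * (if n < x i then 1 else 0)).toReal =
      net.activityProb p u - ∑ k ∈ Finset.range (n + 1), queueProb p i k u := fun n => by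
    have hs1 : Summable fun x : V → ℕ => (p (u, x)).toReal * 1 :=
      summable_prob_slice p u (g := fun _ => 1) (K := 1) fun _ => by simp
    have hs2 : Summable fun x : V → ℕ => (p (u, x)).toReal * if x i ≤ n then 1 else 0 :=
      summable_prob_slice p u (K := 1) fun _ => by split_ifs <;> simp
    rw [sum_queueProb, activityProb_eq, ENNReal.tsum_toReal_eq fun x =>
      ENNReal.mul_ne_top (p.apply_ne_top _) (by split_ifs <;> simp)]
    simp only [mul_one] at hs1
    rw [← hs1.tsum_sub hs2]
    refine tsum_congr fun x => ?_
    by_cases hx : x i ≤ n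
    · simp [hx, not_lt.2 hx]
    · simp [hx, not_le.1 hx]
  rw [← ENNReal.tsum_toReal_eq (ENNReal.ne_top_of_tsum_ne_top (h1 ▸ h)), h1] at h2
  simpa only [h3] using h2

/-- Node `i` as a queue modulated by the activity process. -/
noncomputable def IsStationary.queue (hp : net.IsStationary p) (i : V)
    (hi : net.meanQueue p i ≠ ⊤) : ModulatedQueue hp.chain where
  act := Finset.univ.filter fun u => i ∈ u.1
  lam := net.lam i
  kap := net.mu i * (1 - net.psi i)
  rel := net.mu i * net.psi i
  y k u := queueProb p i k u / net.activityProb p u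
  mean u := (partialMean p i u).toReal / net.activityProb p u
  lam_pos := net.lam_pos i
  kap_nonneg := net.stay_nonneg i
  release_rate v hv := by
    have hv' : i ∈ v.1 := (Finset.mem_filter.1 hv).2
    have hw := isIndepSet_of_subset v (Finset.erase_subset i v.1)
    change ∑ v' ∈ _, net.activityRate v v' = _
    rw [Finset.sum_eq_single (⟨v.1.erase i, hw⟩ : net.Activity)]
    · rw [activityRate_eq_downRate hv' (Finset.notMem_erase i v.1), downRate, if_pos ⟨hv', rfl⟩]
    · intro v' hmem hne
      have hv'' : i ∉ v'.1 := by simpa using hmem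
      rw [activityRate_eq_downRate hv' hv'', downRate, if_neg]
      exact fun h => hne (Subtype.ext h.2)
    · intro h
      simp at h
  y_nonneg k u := div_nonneg (tsum_nonneg fun x => mul_nonneg ENNReal.toReal_nonneg
    (by split_ifs <;> simp)) (activityProb_nonneg p u)
  cut n v := by
    have hpos := fun u => (hp.activityProb_pos u).ne'
    have hrev : ∀ u, net.activityProb p v * net.activityRate v u =
      net.activityProb p u * net.activityRate u v := fun u => hp.chain.reversible v u
    have hq := hp.queue_cut i n v
    have hY : ∀ u, ∑ k ∈ Finset.range (n + 1), queueProb p i k u / net.activityProb p u =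
        (∑ k ∈ Finset.range (n + 1), queueProb p i k u) / net.activityProb p u := fun u =>
      (Finset.sum_div _ _ _).symm
    simp only [hY]
    set Y : net.Activity → ℝ := fun u => ∑ k ∈ Finset.range (n + 1), queueProb p i k u
    apply mul_left_cancel₀ (hpos v)
    -- Reversibility turns the inflow π(u) q(u,v) into π(v) q(v,u), so balance becomes the generator
    -- acting on conditional distributions.
    have hg : net.activityProb p v * hp.chain.gen (fun u => Y u / net.activityProb p u) v =
        ∑ u, net.activityRate u v * Y u - (∑ u, net.activityRate v u) * Y v := by
      rw [ReversibleChain.gen, Finset.mul_sum, Finset.sum_mul, ← Finset.sum_sub_distrib]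
      refine Finset.sum_congr rfl fun u _ => ?_
      change net.activityProb p v * (net.activityRate v u * (Y u / net.activityProb p u -
        Y v / net.activityProb p v)) = _
      have h1 := hrev u
      have h2 := hpos u
      have h3 := hpos v
      field_simp
      linear_combination Y u * h1
    have hlam : net.activityProb p v *
        (net.lam i * (queueProb p i n v / net.activityProb p v)) =
        net.lam i * queueProb p i n v := by
      have h3 := hpos v
      field_simp
    rw [mul_add, hg, hlam, hq, add_assoc]
    congr 1
    by_cases hv : i ∈ v.1
    · rw [if_pos (by simpa using hv), stayRate, if_pos hv,
        Finset.sum_eq_zero fun u _ => ?_]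
      · have h3 := hpos v
        field_simp
        ring
      · rw [downRate, if_neg, zero_mul]
        exact fun h => Finset.notMem_erase i u.1 (h.2 ▸ hv)
    · rw [if_neg (by simpa using hv), stayRate, if_neg hv, zero_mul, zero_add, Finset.mul_sum,
        Finset.sum_filter]
      refine Finset.sum_congr rfl fun u _ => ?_
      by_cases hu : i ∈ u.1
      · rw [if_pos hu, ← activityRate_eq_downRate hu hv]
        change _ = net.activityProb p v * (net.activityRate v u * _)
        have h2 := hpos u
        rw [← mul_assoc, hrev u]
        field_simp
      · rw [if_neg hu, downRate, if_neg fun h => hu h.1, zero_mul]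
  hasSum_tail v := by
    have hfin : partialMean p i v ≠ ⊤ := fun h => hi (by
      rw [← sum_partialMean, ENNReal.sum_eq_top]
      exact ⟨v, Finset.mem_univ v, h⟩)
    have h := (hasSum_activityProb_sub p i v hfin).div_const (net.activityProb p v)
    refine h.congr_fun ?_
    intro n
    rw [sub_div, div_self (hp.activityProb_pos v).ne', Finset.sum_div]

theorem IsStationary.sum_mul_queue_mean (hp : net.IsStationary p) (i : V)
    (hi : net.meanQueue p i ≠ ⊤) :
    ∑ u, net.activityProb p u * (hp.queue i hi).mean u = (net.meanQueue p i).toReal := by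
  rw [← sum_partialMean] at hi ⊢
  rw [ENNReal.toReal_sum fun u hu => ENNReal.sum_ne_top.1 hi u hu]
  refine Finset.sum_congr rfl fun u _ => ?_
  exact mul_div_cancel₀ _ (hp.activityProb_pos u).ne'

end FixedRateNetwork

/-! ### Combining the nodes over a set of activity states. -/

namespace FixedRateNetwork

variable {V : Type*} [Fintype V] [DecidableEq V] {net : FixedRateNetwork V} {p : PMF net.State}

theorem IsStationary.queue_active (hp : net.IsStationary p) (i : V)
    (hi : net.meanQueue p i ≠ ⊤) (u : net.Activity) :
    (hp.queue i hi).active u = if i ∈ u.1 then 1 else 0 := by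
  simp [ModulatedQueue.active, queue]

theorem IsStationary.queue_total_rate (hp : net.IsStationary p) (i : V)
    (hi : net.meanQueue p i ≠ ⊤) : (hp.queue i hi).kap + (hp.queue i hi).rel = net.mu i := by
  change net.mu i * (1 - net.psi i) + net.mu i * net.psi i = net.mu i
  ring

theorem IsStationary.queue_act_nonempty (hp : net.IsStationary p) (i : V)
    (hi : net.meanQueue p i ≠ ⊤) : (hp.queue i hi).act.Nonempty :=
  ⟨⟨{i}, by simp⟩, Finset.mem_filter.2 ⟨Finset.mem_univ _, Finset.mem_singleton_self i⟩⟩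

/-- A node with finite mean queue length is served at least at its arrival rate. -/
theorem IsStationary.lam_le (hp : net.IsStationary p) (i : V) (hi : net.meanQueue p i ≠ ⊤) :
    net.lam i ≤ net.mu i * ∑ u, net.activityProb p u * if i ∈ u.1 then 1 else 0 := by
  have h := (hp.queue i hi).lam_mul_sum_weight_le
  rw [hp.queue_total_rate] at h
  simp only [hp.queue_active] at h
  have h1 : ∑ u, hp.chain.weight u = 1 := sum_activityProb p
  rw [h1, mul_one] at h
  exact h

/-- Each relevant node is served on average at least at its arrival rate, and the π-average of the
aggregate service rate is at most its maximum. -/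
theorem minDrift_univ_nonpos (hp : net.IsStationary p) {w : V → ℝ} (hw : ∀ i, 0 ≤ w i)
    {V' : Finset V} (hfin : ∀ i ∈ V', 0 < w i → net.meanQueue p i ≠ ⊤)
    (hne : (Finset.univ : Finset net.Activity).Nonempty) :
    net.minDrift w V' Finset.univ hne ≤ 0 := by
  rw [minDrift, sub_nonpos]
  calc ∑ i ∈ V', w i * net.lam i
      ≤ ∑ i ∈ V', w i * (net.mu i * ∑ u, net.activityProb p u * if i ∈ u.1 then 1 else 0) := by
        refine Finset.sum_le_sum fun i hi => ?_
        rcases (hw i).eq_or_lt with h | h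
        · simp [← h]
        · exact mul_le_mul_of_nonneg_left (hp.lam_le i (hfin i hi h)) h.le
    _ = ∑ u, net.activityProb p u *
          ∑ i ∈ V', w i * net.mu i * (if i ∈ u.1 then 1 else 0) := by
        simp only [Finset.mul_sum]
        rw [Finset.sum_comm]
        exact Finset.sum_congr rfl fun u _ => Finset.sum_congr rfl fun i _ => by ring
    _ ≤ ∑ u, net.activityProb p u * net.maxServiceRate w V' Finset.univ hne :=
        Finset.sum_le_sum fun u _ => mul_le_mul_of_nonneg_left
          (Finset.le_sup' (fun u : net.Activity =>
            ∑ i ∈ V', w i * net.mu i * (if i ∈ u.1 then 1 else 0)) (Finset.mem_univ u))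
          (activityProb_nonneg p u)
    _ = net.maxServiceRate w V' Finset.univ hne := by
        rw [← Finset.sum_mul, sum_activityProb, one_mul]

theorem exitFlow_eq (S : Finset net.Activity) :
    net.exitFlow p S = ∑ u ∈ S, ∑ u' ∈ Sᶜ, net.activityProb p u * net.activityRate u u' := by
  unfold exitFlow
  congr! 3

theorem IsStationary.exitFlow_pos (hp : net.IsStationary p) {S : Finset net.Activity}
    (hne : S.Nonempty) (hS : S ≠ Finset.univ) : 0 < net.exitFlow p S := by
  rw [exitFlow_eq]
  have hnn : ∀ u u', 0 ≤ net.activityProb p u * net.activityRate u u' := fun u u' =>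
    mul_nonneg (activityProb_nonneg p u) (net.activityRate_nonneg u u')
  refine lt_of_le_of_ne (Finset.sum_nonneg fun u _ => Finset.sum_nonneg fun u' _ => hnn u u')
    fun h0 => hS ?_
  have huniv := net.activity_irreducible (S : Set net.Activity) hne fun v hv v' hr => by
    by_contra hv'
    have h1 := (Finset.sum_eq_zero_iff_of_nonneg fun u _ =>
      Finset.sum_nonneg fun u' _ => hnn u u').1 h0.symm v hv
    have h2 := (Finset.sum_eq_zero_iff_of_nonneg fun u' _ => hnn v u').1 h1 v'
      (Finset.mem_compl.2 hv')
    exact (mul_pos (hp.activityProb_pos v) hr).ne' h2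
  exact_mod_cast huniv

theorem IsStationary.minDrift_mul_le (hp : net.IsStationary p) {w : V → ℝ} (hw : ∀ i, 0 ≤ w i)
    {V' : Finset V} (hfin : ∀ i ∈ V', 0 < w i → net.meanQueue p i ≠ ⊤)
    {S : Finset net.Activity} (hne : S.Nonempty) (hS : S ≠ Finset.univ)
    (hD : 0 ≤ net.minDrift w V' S hne) :
    net.minDrift w V' S hne * net.setProb p S * (net.bottleneckRatio p S)⁻¹ ≤
      2 * ∑ i ∈ V', w i * (net.meanQueue p i).toReal := by
  have hS' : (S : Set net.Activity) ≠ Set.univ := fun h => hS (by exact_mod_cast h)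
  choose D hD0 hD1 using fun i => hp.chain.exists_poisson hS'
    fun u => net.lam i - net.mu i * if i ∈ u.1 then 1 else 0
  obtain ⟨g, hg0, hg1⟩ := hp.chain.exists_poisson hS' fun _ => 1
  have hgnn : ∀ u, 0 ≤ g u := fun u => by
    have := hp.chain.le_of_subharmonic hS' (f := fun v => -1 * g v) (M := 0)
      (fun v hv => by rw [ReversibleChain.gen_const_mul, neg_one_mul, hg1 v hv]; exact zero_le_one)
      (fun v hv => by rw [hg0 v hv, mul_zero]) u
    linarith
  have hnode : ∀ i ∈ V', w i * ∑ u, net.activityProb p u * D i u ≤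
      w i * (2 * (net.meanQueue p i).toReal) := fun i hi => by
    rcases (hw i).eq_or_lt with h | h
    · simp [← h]
    have hm := hfin i hi h
    refine mul_le_mul_of_nonneg_left ?_ h.le
    rw [← hp.sum_mul_queue_mean i hm]
    refine (hp.queue i hm).sum_drift_le_two_mul_mean (hp.queue_act_nonempty i hm) hS
      (hD0 i) fun v hv => ?_
    rw [hD1 i v hv, hp.queue_total_rate, hp.queue_active]
    rfl
  have hsum : net.minDrift w V' S hne * ∑ u, net.activityProb p u * g u ≤
      ∑ i ∈ V', w i * ∑ u, net.activityProb p u * D i u := by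
    calc net.minDrift w V' S hne * ∑ u, net.activityProb p u * g u
        = ∑ u, net.activityProb p u * (g u * net.minDrift w V' S hne) := by
          rw [Finset.mul_sum]
          exact Finset.sum_congr rfl fun u _ => by ring
      _ ≤ ∑ u, net.activityProb p u *
            (g u * -hp.chain.gen (fun v => ∑ i ∈ V', w i * D i v) u) := by
          refine Finset.sum_le_sum fun u _ => mul_le_mul_of_nonneg_left ?_ (activityProb_nonneg p u)
          by_cases hu : u ∈ S
          · refine mul_le_mul_of_nonneg_left ?_ (hgnn u)
            rw [hp.chain.gen_sum V' (fun i v => w i * D i v), ← Finset.sum_neg_distrib]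
            simp only [ReversibleChain.gen_const_mul, ← mul_neg, hD1 _ u hu]
            have := Finset.le_sup' (fun u : net.Activity =>
              ∑ i ∈ V', w i * net.mu i * (if i ∈ u.1 then 1 else 0)) hu
            simp only [mul_sub, Finset.sum_sub_distrib, ← mul_assoc]
            exact sub_le_sub_left this _
          · rw [hg0 u hu, zero_mul, zero_mul]
      -- Symmetry moves the generator onto `g`, where it equals -1 on `S`, the set that supports
      -- every `D i`.
      _ = ∑ u, net.activityProb p u *
            ((∑ i ∈ V', w i * D i u) * -hp.chain.gen g u) := hp.chain.gen_symm _ _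
      _ = ∑ u, net.activityProb p u * ∑ i ∈ V', w i * D i u := by
          refine Finset.sum_congr rfl fun u _ => ?_
          by_cases hu : u ∈ S
          · rw [hg1 u hu, mul_one]
          · rw [Finset.sum_eq_zero fun i _ => by rw [hD0 i u hu, mul_zero], zero_mul]
      _ = ∑ i ∈ V', w i * ∑ u, net.activityProb p u * D i u := by
          simp only [Finset.mul_sum]
          rw [Finset.sum_comm]
          exact Finset.sum_congr rfl fun u _ => Finset.sum_congr rfl fun i _ => by ring
  have hQ := hp.exitFlow_pos hne hS
  have hsq : net.setProb p S ^ 2 ≤ net.exitFlow p S * ∑ u, net.activityProb p u * g u := by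
    rw [exitFlow_eq]
    exact hp.chain.sq_le_exit_mul S hg0 hg1
  calc net.minDrift w V' S hne * net.setProb p S * (net.bottleneckRatio p S)⁻¹
      = net.minDrift w V' S hne * (net.setProb p S ^ 2 / net.exitFlow p S) := by
        rw [bottleneckRatio, inv_div]
        ring
    _ ≤ net.minDrift w V' S hne * ∑ u, net.activityProb p u * g u :=
        mul_le_mul_of_nonneg_left ((div_le_iff₀' hQ).2 hsq) hD
    _ ≤ ∑ i ∈ V', w i * (2 * (net.meanQueue p i).toReal) :=
        hsum.trans (Finset.sum_le_sum hnode)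
    _ = 2 * ∑ i ∈ V', w i * (net.meanQueue p i).toReal := by
        rw [Finset.mul_sum]
        exact Finset.sum_congr rfl fun i _ => by ring

end FixedRateNetwork

theorem proposition1 {V : Type*} [Fintype V] [DecidableEq V]
    (net : FixedRateNetwork V) (p : PMF net.State) (hp : net.IsStationary p)
    (w : V → ℝ) (hw : ∀ i, 0 ≤ w i) (V' : Finset V) :
    ((1 / 2 : ℝ) : EReal) *
        (⨆ (S : Finset net.Activity) (hS : S.Nonempty),
          ((net.minDrift w V' S hS : ℝ) : EReal) * ((net.setProb p S : ℝ) : EReal) *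
            (((ENNReal.ofReal (net.bottleneckRatio p S))⁻¹ : ℝ≥0∞) : EReal))
      ≤ ((∑ i ∈ V', ENNReal.ofReal (w i) * net.meanQueue p i : ℝ≥0∞) : EReal) := by
  by_cases hfin : ∀ i ∈ V', 0 < w i → net.meanQueue p i ≠ ⊤
  swap
  · push Not at hfin
    obtain ⟨i, hi, hwi, htop⟩ := hfin
    have h : ∑ i ∈ V', ENNReal.ofReal (w i) * net.meanQueue p i = ⊤ :=
      ENNReal.sum_eq_top.2 ⟨i, hi, by
        rw [htop, ENNReal.mul_top (ENNReal.ofReal_pos.2 hwi).ne']⟩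
    rw [h, EReal.coe_ennreal_top]
    exact le_top
  set M : ℝ := ∑ i ∈ V', w i * (net.meanQueue p i).toReal with hM
  have hM0 : 0 ≤ M := Finset.sum_nonneg fun i _ => mul_nonneg (hw i) ENNReal.toReal_nonneg
  have hrhs :
      ((∑ i ∈ V', ENNReal.ofReal (w i) * net.meanQueue p i : ℝ≥0∞) : EReal) = (M : EReal) := by
    have h : ∑ i ∈ V', ENNReal.ofReal (w i) * net.meanQueue p i = ENNReal.ofReal M := by
      rw [hM, ENNReal.ofReal_sum_of_nonneg fun i _ => mul_nonneg (hw i) ENNReal.toReal_nonneg]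
      refine Finset.sum_congr rfl fun i hi => ?_
      rw [ENNReal.ofReal_mul (hw i)]
      rcases (hw i).eq_or_lt with h | h
      · simp [← h]
      · rw [ENNReal.ofReal_toReal (hfin i hi h)]
    rw [h, EReal.coe_ennreal_ofReal, max_eq_left hM0]
  have hsup : (⨆ (S : Finset net.Activity) (hS : S.Nonempty),
      ((net.minDrift w V' S hS : ℝ) : EReal) * ((net.setProb p S : ℝ) : EReal) *
        (((ENNReal.ofReal (net.bottleneckRatio p S))⁻¹ : ℝ≥0∞) : EReal)) ≤
      ((2 * M : ℝ) : EReal) := by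
    refine iSup₂_le fun S hS => ?_
    have hP : 0 ≤ net.setProb p S :=
      Finset.sum_nonneg fun u _ => FixedRateNetwork.activityProb_nonneg p u
    -- Nonpositive drift settles S = Ω, where the inverse ratio is `⊤`; positive drift forces `S`
    -- proper, and then all factors are real.
    rcases le_or_gt (net.minDrift w V' S hS) 0 with hD | hD
    · refine le_trans (?_ : _ ≤ (0 : EReal)) (by exact_mod_cast (by positivity : 0 ≤ 2 * M))
      rw [← EReal.coe_mul]
      exact mul_nonpos_of_nonpos_of_nonneg
        (by exact_mod_cast mul_nonpos_of_nonpos_of_nonneg hD hP) (EReal.coe_ennreal_nonneg _)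
    · have hne : S ≠ Finset.univ := by
        rintro rfl
        exact hD.not_ge (FixedRateNetwork.minDrift_univ_nonpos hp hw hfin hS)
      have hB : 0 < net.bottleneckRatio p S := div_pos (hp.exitFlow_pos hS hne)
        (Finset.sum_pos (fun u _ => hp.activityProb_pos u) hS)
      rw [← ENNReal.ofReal_inv_of_pos hB, EReal.coe_ennreal_ofReal,
        max_eq_left (inv_nonneg.2 hB.le), ← EReal.coe_mul, ← EReal.coe_mul]
      exact_mod_cast hp.minDrift_mul_le hw hfin hS hne hD.le
  rw [hrhs]
  calc ((1 / 2 : ℝ) : EReal) * _ ≤ ((1 / 2 : ℝ) : EReal) * ((2 * M : ℝ) : EReal) :=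
        mul_le_mul_of_nonneg_left hsup (by exact_mod_cast (by norm_num : (0 : ℝ) ≤ 1 / 2))
    _ = (M : EReal) := by
        rw [← EReal.coe_mul]
        congr 1
        ring
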